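/- All manifolds are finite-dimensional, Hausdorff, $\sigma$-compact, smooth and without boundary; vector bundles are smooth, real and of finite constant rank. A \emph{Lie algebroid} over $M$ is a vector bundle $E\to M$ with a smooth bundle map $a\colon E\to TM$ over $\mathrm{id}_M$ and an $\mathbb{R}$-bilinear Lie bracket on its space of sections $\Gamma(E)$ such that $[\sigma,f\tau]=f[\sigma,\tau]+(a(\sigma)f)\,\tau$ for $\sigma,\tau\in\Gamma(E)$, $f\in C^\infty(M)$. A \emph{Poisson structure} on a manifold $N$ is an $\mathbb{R}$-bilinear skew-symmetric bracket on $C^\infty(N)$ satisfying the Leibniz rule and the Jacobi identity; its bivector field $\pi$ is given by $\pi(df,dg)=\{f,g\}$. For a vector bundle $V$ let $\kappa_t\colon V\to V$ be scalar multiplication by $t$; a Poisson structure on the total space of $V$ is \emph{(fiberwise) linear} if $\kappa_t^*\pi=t^{-1}\pi$ for all $t\neq 0$. A section $\sigma$ of $E$ defines the function $\phi_\sigma(\xi)=\langle \xi,\sigma(x)\rangle$ $(\xi\in E^*_x)$ on the total space of $E^*$; likewise a section $\sigma$ of $V^*$ defines the function $\phi_\sigma(v)=\langle\sigma(x),v\rangle$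 $(v\in V_x)$ on the total space of $V=(V^*)^*$. \textbf{Theorem.} (a) Let $E\to M$ be a Lie algebroid. There is a fiberwise linear Poisson structure on the total space of $E^*$ such that $$\{\phi_\sigma,\phi_\tau\}=\phi_{[\sigma,\tau]}\qquad\text{for all }\sigma,\tau\in\Gamma(E),\tag{1}$$ and it is the only fiberwise linear Poisson structure with this property. If $\operatorname{rank}E\ge 1$ or $\dim M\le 1$, it is the only Poisson structure on $E^*$ (linear or not) satisfying (1). (b) Conversely, for every vector bundle $V\to M$ and every fiberwise linear Poisson structure $\{\cdot,\cdot\}$ on the total space of $V$ there is a unique Lie algebroid structure on the dual bundle $V^*$ such that $\{\phi_\sigma,\phi_\tau\}=\phi_{[\sigma,\tau]}$ for all $\sigma,\tau\in\Gamma(V^*)$. -/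

import Mathlib

open Bundle Module
open scoped Manifold ContDiff Bundle

noncomputable section

/-! ### Multivector fields and Poisson structures on a manifold -/

section Poisson

variable {EN : Type*} [NormedAddCommGroup EN] [NormedSpace ℝ EN]
  {HN : Type*} [TopologicalSpace HN] (J : ModelWithCorners ℝ EN HN)
  {N : Type*} [TopologicalSpace N] [ChartedSpace HN N]

/-- The cotangent space `T*_x N`. -/
abbrev CotangentSpace (x : N) : Type _ := TangentSpace J x →L[ℝ] ℝ

/-- The differential `d_x f` of a smooth function, as an element of `T*_x N`. -/
def differential (f : C^∞⟮J, N; 𝓘(ℝ), ℝ⟯) (x : N) : CotangentSpace J x :=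
  mvfderiv J (f : N → ℝ) x

variable (N) in
/-- Fields of `k`-vectors on `N`: an element of `⋀ᵏ T_x N` is regarded as an alternating `k`-linear
form on `T*_x N`. No smoothness is built into this type; the bivector field of a Poisson structure
is smooth because the Poisson bracket of two smooth functions is smooth. -/
abbrev MultivectorField (k : ℕ) : Type _ := ∀ x : N, CotangentSpace J x [⋀^Fin k]→ₗ[ℝ] ℝ

/-- The pull-back `κ^* u` of a `k`-vector field `u` under a diffeomorphism `κ : N → N`:
`(κ^* u)_x (α₁, …, α_k) = u_{κ x} (α₁ ∘ (T_x κ)⁻¹, …, α_k ∘ (T_x κ)⁻¹)`. -/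
def MultivectorField.pullback {k : ℕ} (κ : N → N) (u : MultivectorField J N k) :
    MultivectorField J N k := fun x ↦
  (u (κ x)).compLinearMap
    { toFun := fun α : CotangentSpace J x ↦
        (α.comp (mfderiv J J κ x).inverse : CotangentSpace J (κ x))
      map_add' := fun α β ↦ ContinuousLinearMap.add_comp α β _
      map_smul' := fun c α ↦ ContinuousLinearMap.smul_comp c α _ }

variable (N) in
/-- A Poisson structure on `N`: an `ℝ`-bilinear, skew-symmetric bracket on `C^∞(N)` which is
a derivation in the second argument and satisfies the Jacobi identity. -/
@[ext]
structure PoissonStructure where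
  /-- the Poisson bracket `{f, g}` -/
  bracket : C^∞⟮J, N; 𝓘(ℝ), ℝ⟯ →ₗ[ℝ] C^∞⟮J, N; 𝓘(ℝ), ℝ⟯ →ₗ[ℝ] C^∞⟮J, N; 𝓘(ℝ), ℝ⟯
  skew : ∀ f g, bracket f g = -bracket g f
  leibniz : ∀ f g h, bracket f (g * h) = bracket f g * h + g * bracket f h
  jacobi : ∀ f g h, bracket f (bracket g h) = bracket (bracket f g) h + bracket g (bracket f h)

/-- `u` is the bivector field `π` of the Poisson structure `P`, that is `π(df, dg) = {f, g}`. -/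
def PoissonStructure.HasBivector (P : PoissonStructure J N) (u : MultivectorField J N 2) : Prop :=
  ∀ (f g : C^∞⟮J, N; 𝓘(ℝ), ℝ⟯) (x : N),
    u x ![differential J f x, differential J g x] = P.bracket f g x

end Poisson

/-! ### Vector bundles, Lie algebroids and fiberwise linear Poisson structures -/

section VectorBundle

variable {EM : Type*} [NormedAddCommGroup EM] [NormedSpace ℝ EM]
  {HM : Type*} [TopologicalSpace HM] (I : ModelWithCorners ℝ EM HM)
  {M : Type*} [TopologicalSpace M] [ChartedSpace HM M]
  (F : Type*) [NormedAddCommGroup F] [NormedSpace ℝ F]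
  (E : M → Type*) [TopologicalSpace (TotalSpace F E)]
  [∀ x, AddCommGroup (E x)] [∀ x, Module ℝ (E x)] [∀ x, TopologicalSpace (E x)]
  [FiberBundle F E] [VectorBundle ℝ F E]

variable {E} in
/-- Scalar multiplication `κ_t` by `t` on the total space of a vector bundle. -/
def fiberScaling (t : ℝ) : TotalSpace F E → TotalSpace F E := fun v ↦ ⟨v.proj, t • v.2⟩

variable {F E} in
/-- A `k`-vector field `u` on the total space of a vector bundle is (fiberwise) linear if it is
homogeneous of degree `1 - k`, that is `κ_t^* u = t ^ (1 - k) • u` for all `t ≠ 0`. -/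
def MultivectorField.IsFiberwiseLinear {k : ℕ}
    (u : MultivectorField (I.prod 𝓘(ℝ, F)) (TotalSpace F E) k) : Prop :=
  ∀ t : ℝ, t ≠ 0 →
    MultivectorField.pullback (I.prod 𝓘(ℝ, F)) (fiberScaling F t) u = (t ^ (1 - (k : ℤ))) • u

variable {F E} in
/-- A Poisson structure on the total space of a vector bundle is (fiberwise) linear if its
bivector field is. -/
def PoissonStructure.IsFiberwiseLinear
    (P : PoissonStructure (I.prod 𝓘(ℝ, F)) (TotalSpace F E)) : Prop :=
  ∃ u : MultivectorField (I.prod 𝓘(ℝ, F)) (TotalSpace F E) 2,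
    PoissonStructure.HasBivector (I.prod 𝓘(ℝ, F)) P u ∧
      MultivectorField.IsFiberwiseLinear I u

variable {I F E} in
/-- The product `f σ` of a smooth function and a smooth section. -/
def ContMDiffSection.funSMul (f : C^∞⟮I, M; 𝓘(ℝ), ℝ⟯) (σ : Cₛ^∞⟮I; F, E⟯) : Cₛ^∞⟮I; F, E⟯ where
  toFun x := f x • σ x
  contMDiff_toFun := f.contMDiff.smul_section σ.contMDiff

/-- A Lie algebroid structure on the vector bundle `E → M`: a Lie bracket on the space `Γ(E)` of
smooth sections and a smooth bundle map `a : E → TM` (the anchor), such that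
`[σ, f τ] = f [σ, τ] + (a(σ) f) τ`. -/
@[ext]
structure LieAlgebroidStructure [IsManifold I ∞ M] where
  /-- the Lie bracket on `Γ(E)` -/
  bracket : Cₛ^∞⟮I; F, E⟯ →ₗ[ℝ] Cₛ^∞⟮I; F, E⟯ →ₗ[ℝ] Cₛ^∞⟮I; F, E⟯
  /-- the anchor, as a smooth section of `Hom(E, TM)` -/
  anchor : Cₛ^∞⟮I; F →L[ℝ] EM, fun x ↦ E x →L[ℝ] TangentSpace I x⟯
  bracket_self : ∀ σ, bracket σ σ = 0
  jacobi : ∀ σ τ ρ,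
    bracket σ (bracket τ ρ) = bracket (bracket σ τ) ρ + bracket τ (bracket σ ρ)
  leibniz : ∀ (σ τ : Cₛ^∞⟮I; F, E⟯) (f : C^∞⟮I, M; 𝓘(ℝ), ℝ⟯) (x : M),
    bracket σ (ContMDiffSection.funSMul f τ) x =
      f x • bracket σ τ x + differential I f x (anchor x (σ x)) • τ x

/-- The dual bundle `E*`, with fibers `E* x = (E x)*`; its model fiber is `F →L[ℝ] ℝ`. -/
abbrev DualBundle : M → Type _ := fun x ↦ E x →L[ℝ] Bundle.Trivial M ℝ x

variable {I F E}

/-- The linear function `φ_σ` on the total space of `E*` defined by a section `σ` of `E`: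
`φ_σ(ξ) = ⟨ξ, σ(x)⟩` for `ξ ∈ E* x`. -/
def linearFunction [ContMDiffVectorBundle ∞ F E I] (σ : Cₛ^∞⟮I; F, E⟯) :
    C^∞⟮I.prod 𝓘(ℝ, F →L[ℝ] ℝ), TotalSpace (F →L[ℝ] ℝ) (DualBundle E); 𝓘(ℝ), ℝ⟯ where
  val ξ := ξ.2 (σ ξ.proj)
  property := by
    have h : ContMDiff (I.prod 𝓘(ℝ, F →L[ℝ] ℝ)) (I.prod 𝓘(ℝ, ℝ)) ∞
        (fun ξ : TotalSpace (F →L[ℝ] ℝ) (DualBundle E) ↦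
          TotalSpace.mk' ℝ (E := Bundle.Trivial M ℝ) ξ.proj (ξ.2 (σ ξ.proj))) :=
      ContMDiff.clm_bundle_apply (F₁ := F) (F₂ := ℝ) contMDiff_id
        (σ.contMDiff.comp (contMDiff_proj (DualBundle E)))
    exact fun ξ ↦ (contMDiffAt_totalSpace.1 (h ξ)).2

/-- The linear function `φ_σ` on the total space of `E` defined by a section `σ` of `E*`:
`φ_σ(v) = ⟨σ(x), v⟩` for `v ∈ E x`. This is the linear function on `(E*)*` defined by the section
`σ` of `E*`, read through the canonical identification `E = (E*)*`. -/
def linearFunctionOfDual [ContMDiffVectorBundle ∞ F E I]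
    (σ : Cₛ^∞⟮I; F →L[ℝ] ℝ, DualBundle E⟯) :
    C^∞⟮I.prod 𝓘(ℝ, F), TotalSpace F E; 𝓘(ℝ), ℝ⟯ where
  val v := σ v.proj v.2
  property := by
    have h : ContMDiff (I.prod 𝓘(ℝ, F)) (I.prod 𝓘(ℝ, ℝ)) ∞
        (fun v : TotalSpace F E ↦
          TotalSpace.mk' ℝ (E := Bundle.Trivial M ℝ) v.proj (σ v.proj v.2)) :=
      ContMDiff.clm_bundle_apply (F₁ := F) (F₂ := ℝ)
        (σ.contMDiff.comp (contMDiff_proj E)) contMDiff_id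
    exact fun v ↦ (contMDiffAt_totalSpace.1 (h v)).2

/-- The relation `{φ_σ, φ_τ} = φ_[σ,τ]` on `E*`, for a Lie algebroid `E`. -/
def LieAlgebroidStructure.Induces [IsManifold I ∞ M] [ContMDiffVectorBundle ∞ F E I]
    (A : LieAlgebroidStructure I F E)
    (P : PoissonStructure (I.prod 𝓘(ℝ, F →L[ℝ] ℝ)) (TotalSpace (F →L[ℝ] ℝ) (DualBundle E))) :
    Prop :=
  ∀ σ τ : Cₛ^∞⟮I; F, E⟯,
    P.bracket (linearFunction σ) (linearFunction τ) = linearFunction (A.bracket σ τ)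

/-- The relation `{φ_σ, φ_τ} = φ_[σ,τ]` on `E = (E*)*`, for a Lie algebroid `E*`. -/
def LieAlgebroidStructure.InducesOnPredual [IsManifold I ∞ M] [ContMDiffVectorBundle ∞ F E I]
    (A : LieAlgebroidStructure I (F →L[ℝ] ℝ) (DualBundle E))
    (P : PoissonStructure (I.prod 𝓘(ℝ, F)) (TotalSpace F E)) : Prop :=
  ∀ σ τ : Cₛ^∞⟮I; F →L[ℝ] ℝ, DualBundle E⟯,
    P.bracket (linearFunctionOfDual σ) (linearFunctionOfDual τ) =
      linearFunctionOfDual (A.bracket σ τ)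

end VectorBundle

end

/-! Write p for a bundle projection. A Poisson bracket is a derivation in each argument, so its
value at a point depends only on the two differentials there; this rests on Hadamard's lemma
(`derivation_eq_zero_of_differential_eq_zero`). It is therefore determined by its values on any
family of functions whose differentials fill every cotangent space. On E* the affine functions φ_σ +
p*u form such a family (`exists_differential_affineFunction_eq`).

Existence in (a): the pairs (σ, u) carry the semidirect product bracket ([σ,τ], a(σ)v - a(τ)u), a
Lie bracket because the anchor is a homomorphism (`anchorAction_bracket`). It descends to a bivector
on E* once the affine function of a bracket is known to vanish at ξ whenever one of the two affine
functions has zero differential at ξ (`affineBracket_apply_eq_zero`). The general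
`exists_poissonStructure` then applies: smoothness holds since differentials of affine functions
give local frames, and the Jacobi identity since the Jacobiator is again a derivation in each
argument. Linearity is checked on affine functions.

Uniqueness in (a): expanding {φ_σ, φ_{fτ}} by both Leibniz rules gives {φ_σ, p*f} φ_τ = p*(a(σ)f)
φ_τ. In positive rank φ_τ can be cancelled, as the nonzero covectors are dense; inserting fτ for σ
then gives {p*f, p*g} = 0. In rank zero every φ_σ vanishes, and {p*f, p*g} = 0 comes from linearity
or from dim M ≤ 1.

Part (b) is a count of degrees under fiber scaling. For a linear Poisson structure {p*f, p*g} has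
degree -1, hence is zero; {φ_σ, p*f} has degree 0, hence is constant on fibers and yields the
anchor; {φ_σ, φ_τ} has degree 1, and a smooth function of degree 1 is fiberwise linear, hence some
φ_ρ. The Lie algebroid axioms are then read off from the Poisson axioms. -/

set_option linter.unusedSectionVars false

noncomputable section

/-! ### Hadamard's lemma with smooth coefficients. -/

section Hadamard

open Set MeasureTheory Filter Topology

universe u

/-- Induction on the order by differentiation under the integral. The target `G` is quantified
inside the induction because the derivative takes values in `X →L[ℝ] G`; sharing a universe with `X`
keeps that space admissible. -/
theorem contDiff_parametric_intervalIntegral {X : Type u} [NormedAddCommGroup X] [NormedSpace ℝ X]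
    [ProperSpace X] (a b : ℝ) (n : ℕ) :
    ∀ {G : Type u} [NormedAddCommGroup G] [NormedSpace ℝ G] [CompleteSpace G] {f : X × ℝ → G},
      ContDiff ℝ n f → ContDiff ℝ n (fun y ↦ ∫ t in a..b, f (y, t)) := by
  induction n with
  | zero =>
    intro G _ _ _ f hf
    rw [Nat.cast_zero, contDiff_zero] at hf ⊢
    exact intervalIntegral.continuous_parametric_intervalIntegral_of_continuous'
      (f := fun y t ↦ f (y, t)) hf a b
  | succ n ih =>
    intro G _ _ _ f hf
    let f' : X × ℝ → X →L[ℝ] G := fun p ↦ (fderiv ℝ f p).comp (ContinuousLinearMap.inl ℝ X ℝ)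
    have hf' : ContDiff ℝ n f' :=
      (hf.fderiv_right (m := n) (by norm_cast)).clm_comp contDiff_const
    have hderiv : ∀ y t, HasFDerivAt (fun z ↦ f (z, t)) (f' (y, t)) y := fun y t ↦ by
      have h1 := (hf.differentiable (by simp) (y, t)).hasFDerivAt
      exact h1.comp y (hasFDerivAt_prodMk_left y t)
    have key : ∀ y, HasFDerivAt (fun y ↦ ∫ t in a..b, f (y, t)) (∫ t in a..b, f' (y, t)) y := by
      intro y
      -- Compactness of the closed ball times the interval provides a constant dominating function.
      obtain ⟨C, hC⟩ := ((isCompact_closedBall y 1).prod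
        (isCompact_uIcc (a := a) (b := b))).exists_bound_of_continuousOn hf'.continuous.continuousOn
      refine intervalIntegral.hasFDerivAt_integral_of_dominated_of_fderiv_le
        (F' := fun z t ↦ f' (z, t)) (bound := fun _ ↦ C)
        (Metric.closedBall_mem_nhds y one_pos) ?_ ?_ ?_ ?_ ?_ ?_
      · exact Eventually.of_forall fun z ↦
          (hf.continuous.comp (Continuous.prodMk_right z)).aestronglyMeasurable
      · exact (hf.continuous.comp (Continuous.prodMk_right y)).intervalIntegrable _ _
      · exact (hf'.continuous.comp (Continuous.prodMk_right y)).aestronglyMeasurable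
      · exact Eventually.of_forall fun t ht z hz ↦ hC (z, t) ⟨hz, uIoc_subset_uIcc ht⟩
      · exact intervalIntegrable_const
      · exact Eventually.of_forall fun t _ z _ ↦ hderiv z t
    rw [Nat.cast_add, Nat.cast_one, contDiff_succ_iff_fderiv]
    refine ⟨fun y ↦ (key y).differentiableAt, fun h ↦ by simp at h, ?_⟩
    rw [show fderiv ℝ (fun y ↦ ∫ t in a..b, f (y, t)) = fun y ↦ ∫ t in a..b, f' (y, t) from
      funext fun y ↦ (key y).fderiv]
    exact ih hf'

/-- Hadamard's lemma. -/
theorem exists_contDiff_eq_add_apply_sub {X : Type u} [NormedAddCommGroup X] [NormedSpace ℝ X]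
    [FiniteDimensional ℝ X] {f : X → ℝ} (hf : ContDiff ℝ ∞ f) (y₀ : X) :
    ∃ g : X → X →L[ℝ] ℝ, ContDiff ℝ ∞ g ∧ g y₀ = fderiv ℝ f y₀ ∧
      ∀ y, f y = f y₀ + g y (y - y₀) := by
  have : ProperSpace X := FiniteDimensional.proper ℝ X
  have hΦ : ContDiff ℝ ∞ (fun p : X × ℝ ↦ fderiv ℝ f (y₀ + p.2 • (p.1 - y₀))) :=
    (hf.fderiv_right (m := ∞) (by simp)).comp (by fun_prop)
  -- The coefficient is the mean of the derivative along the segment from `y₀` to `y`.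
  refine ⟨fun y ↦ ∫ t in (0 : ℝ)..1, fderiv ℝ f (y₀ + t • (y - y₀)), ?_, by simp, fun y ↦ ?_⟩
  · rw [contDiff_infty]
    exact fun n ↦ contDiff_parametric_intervalIntegral 0 1 n (hΦ.of_le (by exact_mod_cast le_top))
  · have hc : Continuous fun t : ℝ ↦ fderiv ℝ f (y₀ + t • (y - y₀)) :=
      hΦ.continuous.comp (Continuous.prodMk_right y)
    beta_reduce
    rw [ContinuousLinearMap.intervalIntegral_apply (hc.intervalIntegrable _ _)]
    have hd : ∀ t ∈ uIcc (0 : ℝ) 1, HasDerivAt (fun t : ℝ ↦ f (y₀ + t • (y - y₀)))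
        (fderiv ℝ f (y₀ + t • (y - y₀)) (y - y₀)) t := fun t _ ↦ by
      have h1 := (hf.differentiable (by simp) (y₀ + t • (y - y₀))).hasFDerivAt
      have h2 : HasDerivAt (fun t : ℝ ↦ y₀ + t • (y - y₀)) (y - y₀) t := by
        simpa using ((hasDerivAt_id t).smul_const (y - y₀)).const_add y₀
      exact h1.comp_hasDerivAt t h2
    rw [intervalIntegral.integral_eq_sub_of_hasDerivAt hd
      ((hc.clm_apply continuous_const).intervalIntegrable _ _)]
    simp

end Hadamard

/-! ### Differentials, bump functions and derivations at a point. -/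

section SmoothFunctions

open Set Filter Topology

universe u

variable {EN : Type u} [NormedAddCommGroup EN] [NormedSpace ℝ EN]
  {HN : Type*} [TopologicalSpace HN] {J : ModelWithCorners ℝ EN HN}
  {N : Type*} [TopologicalSpace N] [ChartedSpace HN N]

theorem ContMDiffMap.mdifferentiableAt_infty (f : C^∞⟮J, N; 𝓘(ℝ), ℝ⟯) (x : N) :
    MDifferentiableAt J 𝓘(ℝ) f x :=
  (f.contMDiff x).mdifferentiableAt (by simp)

theorem differential_add (f g : C^∞⟮J, N; 𝓘(ℝ), ℝ⟯) (x : N) :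
    differential J (f + g) x = differential J f x + differential J g x :=
  mvfderiv_add (f.mdifferentiableAt_infty x) (g.mdifferentiableAt_infty x)

theorem differential_mul (f g : C^∞⟮J, N; 𝓘(ℝ), ℝ⟯) (x : N) :
    differential J (f * g) x = f x • differential J g x + g x • differential J f x :=
  mvfderiv_mul (f.mdifferentiableAt_infty x) (g.mdifferentiableAt_infty x)

theorem differential_smul (c : ℝ) (f : C^∞⟮J, N; 𝓘(ℝ), ℝ⟯) (x : N) :
    differential J (c • f) x = c • differential J f x := by
  have h := mvfderiv_mul (mdifferentiableAt_const (c := c)) (f.mdifferentiableAt_infty x)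
  rw [mvfderiv_const, smul_zero, add_zero] at h
  exact h

variable (J) in
/-- The differential at `x`, as a linear map on smooth functions. -/
def differentialₗ (x : N) : C^∞⟮J, N; 𝓘(ℝ), ℝ⟯ →ₗ[ℝ] CotangentSpace J x where
  toFun f := differential J f x
  map_add' f g := differential_add f g x
  map_smul' c f := differential_smul c f x

theorem differential_zero (x : N) : differential J (0 : C^∞⟮J, N; 𝓘(ℝ), ℝ⟯) x = 0 :=
  (differentialₗ J x).map_zero

theorem differential_sub (f g : C^∞⟮J, N; 𝓘(ℝ), ℝ⟯) (x : N) :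
    differential J (f - g) x = differential J f x - differential J g x :=
  (differentialₗ J x).map_sub f g

theorem differential_sum {ι : Type*} (s : Finset ι) (f : ι → C^∞⟮J, N; 𝓘(ℝ), ℝ⟯) (x : N) :
    differential J (∑ i ∈ s, f i) x = ∑ i ∈ s, differential J (f i) x :=
  map_sum (differentialₗ J x) f s

theorem differential_congr {f g : C^∞⟮J, N; 𝓘(ℝ), ℝ⟯} {x : N} (h : f =ᶠ[𝓝 x] g) :
    differential J f x = differential J g x := by
  have h1 : mfderiv J 𝓘(ℝ) f x = mfderiv J 𝓘(ℝ) g x := h.mfderiv_eq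
  ext v
  exact DFunLike.congr_fun h1 v

theorem differential_comp {EN' : Type*} [NormedAddCommGroup EN'] [NormedSpace ℝ EN']
    {HN' : Type*} [TopologicalSpace HN'] {J' : ModelWithCorners ℝ EN' HN'}
    {N' : Type*} [TopologicalSpace N'] [ChartedSpace HN' N']
    (f : C^∞⟮J, N; 𝓘(ℝ), ℝ⟯) (k : C^∞⟮J', N'; J, N⟯) (x : N') :
    differential J' (f.comp k) x = (differential J f (k x)).comp (mfderiv J' J k x) :=
  mvfderiv_comp x (f.mdifferentiableAt_infty _) ((k.contMDiff x).mdifferentiableAt (by simp))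

section Bump

variable [FiniteDimensional ℝ EN] [T2Space N] [IsManifold J ∞ N]

theorem exists_contMDiffMap_eventuallyEq_one {x : N} {s : Set N} (hs : s ∈ 𝓝 x) :
    ∃ χ : C^∞⟮J, N; 𝓘(ℝ), ℝ⟯, χ =ᶠ[𝓝 x] 1 ∧ tsupport χ ⊆ s := by
  obtain ⟨χ, -, hχ⟩ := (SmoothBumpFunction.nhds_basis_tsupport (I := J) x).mem_iff.1 hs
  exact ⟨⟨χ, χ.contMDiff⟩, χ.eventuallyEq_one, hχ⟩

omit [FiniteDimensional ℝ EN] [T2Space N] [IsManifold J ∞ N] in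
theorem exists_contMDiffMap_eq_mul {χ : C^∞⟮J, N; 𝓘(ℝ), ℝ⟯} {s : Set N} (hs : IsOpen s)
    (hχ : tsupport χ ⊆ s) {g : N → ℝ} (hg : ContMDiffOn J 𝓘(ℝ) ∞ g s) :
    ∃ h : C^∞⟮J, N; 𝓘(ℝ), ℝ⟯, ∀ y, h y = χ y * g y := by
  refine ⟨⟨fun y ↦ χ y * g y, contMDiff_of_tsupport fun y hy ↦ ?_⟩, fun y ↦ rfl⟩
  have hy : y ∈ s := hχ (tsupport_mul_subset_left hy)
  exact (χ.contMDiff y).mul (hg.contMDiffAt (hs.mem_nhds hy))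

theorem exists_contMDiffMap_eventuallyEq {x : N} {s : Set N} (hs : s ∈ 𝓝 x)
    {g : N → ℝ} (hg : ContMDiffOn J 𝓘(ℝ) ∞ g s) :
    ∃ h : C^∞⟮J, N; 𝓘(ℝ), ℝ⟯, h =ᶠ[𝓝 x] g := by
  obtain ⟨t, hts, ht, hxt⟩ := mem_nhds_iff.1 hs
  obtain ⟨χ, h1, hχ⟩ := exists_contMDiffMap_eventuallyEq_one (J := J) (ht.mem_nhds hxt)
  obtain ⟨h, hh⟩ := exists_contMDiffMap_eq_mul ht hχ (hg.mono hts)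
  exact ⟨h, h1.mono fun y hy ↦ by simp [hh, hy]⟩

variable [J.Boundaryless]

omit [FiniteDimensional ℝ EN] [T2Space N] [IsManifold J ∞ N] in
theorem differential_eq_fderiv (f : C^∞⟮J, N; 𝓘(ℝ), ℝ⟯) (x : N) :
    differential J f x = fderiv ℝ (f ∘ (extChartAt J x).symm) (extChartAt J x x) := by
  have h := (f.mdifferentiableAt_infty x).mvfderiv
  rw [J.range_eq_univ, fderivWithin_univ] at h
  exact h

omit [T2Space N] [FiniteDimensional ℝ EN] [J.Boundaryless] in
theorem contMDiffOn_comp_extChartAt_symm (f : C^∞⟮J, N; 𝓘(ℝ), ℝ⟯) (x : N) :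
    ContMDiffOn 𝓘(ℝ, EN) 𝓘(ℝ) ∞ (f ∘ (extChartAt J x).symm) (extChartAt J x).target :=
  f.contMDiff.comp_contMDiffOn (contMDiffOn_extChartAt_symm x)

omit [T2Space N] [FiniteDimensional ℝ EN] in
-- The chart at `x` stays fixed while `y` moves, so the dependence of the differential on `y` can be
-- analysed in one vector space.
theorem differential_eq_fderiv_comp (f : C^∞⟮J, N; 𝓘(ℝ), ℝ⟯) {x y : N}
    (hy : y ∈ (extChartAt J x).source) :
    differential J f y = (fderiv ℝ (f ∘ (extChartAt J x).symm) (extChartAt J x y)).comp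
      (mfderiv J 𝓘(ℝ, EN) (extChartAt J x) y) := by
  have hφ := mdifferentiableAt_extChartAt (I := J) (x := x) (y := y) (by simpa using hy)
  have hf : MDifferentiableAt 𝓘(ℝ, EN) 𝓘(ℝ) (f ∘ (extChartAt J x).symm) (extChartAt J x y) :=
    (((f.contMDiff.comp_contMDiffOn (contMDiffOn_extChartAt_symm (n := ∞) x)).contMDiffAt
      ((isOpen_extChartAt_target x).mem_nhds ((extChartAt J x).map_source hy)))).mdifferentiableAt
      (by simp)
  have h1 : (f : N → ℝ) =ᶠ[𝓝 y] (f ∘ (extChartAt J x).symm) ∘ extChartAt J x := by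
    filter_upwards [(isOpen_extChartAt_source (I := J) x).mem_nhds hy] with z hz
    rw [Function.comp_apply, Function.comp_apply, (extChartAt J x).left_inv hz]
  have h2 := h1.mfderiv_eq (I := J) (I' := 𝓘(ℝ))
  rw [mfderiv_comp y hf hφ, mfderiv_eq_fderiv] at h2
  ext v
  exact DFunLike.congr_fun h2 v

theorem exists_differential_eq (x : N) (α : CotangentSpace J x) :
    ∃ f : C^∞⟮J, N; 𝓘(ℝ), ℝ⟯, differential J f x = α := by
  let α' : EN →L[ℝ] ℝ := α
  have hg : ContMDiffOn J 𝓘(ℝ) ∞ (α' ∘ extChartAt J x) (extChartAt J x).source := by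
    rw [extChartAt_source]
    exact α'.contMDiff.comp_contMDiffOn contMDiffOn_extChartAt
  obtain ⟨f, hf⟩ := exists_contMDiffMap_eventuallyEq (extChartAt_source_mem_nhds x) hg
  refine ⟨f, ?_⟩
  rw [differential_eq_fderiv]
  have h : f ∘ (extChartAt J x).symm =ᶠ[𝓝 (extChartAt J x x)] α' := by
    have h1 := (continuousAt_extChartAt_symm (I := J) x).eventually
      (by rw [extChartAt_to_inv]; exact hf)
    filter_upwards [h1, extChartAt_target_mem_nhds (I := J) x] with y hy hy'
    rw [Function.comp_apply, hy, Function.comp_apply, (extChartAt J x).right_inv hy']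
  rw [h.fderiv_eq]
  exact α'.fderiv

/-- By Hadamard, `f - f x` is near `x` a sum of products of a coefficient and a coordinate
difference. If the differential is zero, both factors vanish at `x`, and a derivation kills such
products. -/
theorem derivation_eq_zero_of_differential_eq_zero {x : N}
    (D : C^∞⟮J, N; 𝓘(ℝ), ℝ⟯ →ₗ[ℝ] ℝ) (hD : ∀ f g, D (f * g) = D f * g x + f x * D g)
    {f : C^∞⟮J, N; 𝓘(ℝ), ℝ⟯} (hf : differential J f x = 0) : D f = 0 := by
  set φ := extChartAt J x with hφ
  obtain ⟨F, hF⟩ := exists_contMDiffMap_eventuallyEq (extChartAt_target_mem_nhds (I := J) x)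
    (contMDiffOn_comp_extChartAt_symm f x)
  obtain ⟨G, hG, hG0, hGF⟩ := exists_contDiff_eq_add_apply_sub F.contMDiff.contDiff (φ x)
  rw [hF.fderiv_eq, ← differential_eq_fderiv, hf] at hG0
  have hFφ : ∀ᶠ y in 𝓝 x, F (φ y) = f y := by
    filter_upwards [(continuousAt_extChartAt (I := J) x).eventually hF,
      extChartAt_source_mem_nhds (I := J) x] with y hy hy'
    rw [hφ, hy, Function.comp_apply, (extChartAt J x).left_inv hy']
  obtain ⟨s, hs, hso, hxs⟩ := mem_nhds_iff.1 (hFφ.and (extChartAt_source_mem_nhds (I := J) x))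
  obtain ⟨χ, h1, hχ⟩ := exists_contMDiffMap_eventuallyEq_one (J := J) (hso.mem_nhds hxs)
  have hφs : ContMDiffOn J 𝓘(ℝ, EN) ∞ φ s :=
    contMDiffOn_extChartAt.mono fun y hy ↦ (extChartAt_source J x) ▸ (hs hy).2
  let b := finBasis ℝ EN
  have hA : ∀ i, ∃ h : C^∞⟮J, N; 𝓘(ℝ), ℝ⟯, ∀ y, h y = χ y * G (φ y) (b i) := fun i ↦
    exists_contMDiffMap_eq_mul hso hχ
      ((hG.clm_apply contDiff_const).contMDiff.comp_contMDiffOn hφs)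
  have hB : ∀ i, ∃ h : C^∞⟮J, N; 𝓘(ℝ), ℝ⟯,
      ∀ y, h y = χ y * (b.coord i).toContinuousLinearMap (φ y - φ x) := fun i ↦
    exists_contMDiffMap_eq_mul hso hχ
      (((b.coord i).toContinuousLinearMap.contDiff.comp
        (contDiff_id.sub contDiff_const)).contMDiff.comp_contMDiffOn hφs)
  choose A hA using hA
  choose B hB using hB
  have hχx : χ x = 1 := h1.self_of_nhds
  let c : C^∞⟮J, N; 𝓘(ℝ), ℝ⟯ := ContMDiffMap.const (f x)
  have hfx : F (φ x) = f x := hFφ.self_of_nhds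
  -- One cutoff for each factor makes both globally smooth. The cutoffs do not change the value of
  -- `D`, because `χ x = 1` and `f - c` vanishes at `x`.
  have hsum : χ * (χ * (f - c)) = ∑ i, A i * B i := by
    ext y
    have h2 : (∑ i, A i * B i : C^∞⟮J, N; 𝓘(ℝ), ℝ⟯) y = ∑ i, A i y * B i y := by
      have := congrFun (map_sum (ContMDiffMap.coeFnRingHom (I := J) (n := ∞) (N := N) (R := ℝ))
        (fun i ↦ A i * B i) Finset.univ) y
      simpa using this
    rw [h2]
    change χ y * (χ y * (f y - f x)) = _
    by_cases hy : y ∈ s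
    · have h3 := hGF (φ y)
      rw [(hs hy).1, hfx] at h3
      have h4 : G (φ y) (φ y - φ x) = ∑ i, b.repr (φ y - φ x) i * G (φ y) (b i) := by
        conv_lhs => rw [← b.sum_repr (φ y - φ x)]
        simp
      rw [h3, add_sub_cancel_left, h4, Finset.mul_sum, Finset.mul_sum]
      refine Finset.sum_congr rfl fun i _ ↦ ?_
      rw [hA, hB]
      simp only [LinearMap.coe_toContinuousLinearMap', Basis.coord_apply]
      ring
    · have h0 : χ y = 0 := image_eq_zero_of_notMem_tsupport fun h ↦ hy (hχ h)
      simp [h0, hA]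
  have hD1 : D 1 = 0 := by
    have := hD 1 1
    simp only [mul_one] at this
    have h1x : (1 : C^∞⟮J, N; 𝓘(ℝ), ℝ⟯) x = 1 := rfl
    rw [h1x] at this
    linarith
  have hDc : D c = 0 := by
    have : c = f x • (1 : C^∞⟮J, N; 𝓘(ℝ), ℝ⟯) := by
      ext y; exact (mul_one (f x)).symm
    rw [this, map_smul, hD1, smul_zero]
  have h5 := congrArg D hsum
  have hcx : (f - c) x = 0 := sub_self (f x)
  rw [hD, hD, map_sub, hDc, map_sum, ContMDiffMap.coe_mul, Pi.mul_apply, hcx, hχx] at h5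
  have h6 : ∀ i, D (A i * B i) = 0 := fun i ↦ by
    have h0 : (0 : EN →L[ℝ] ℝ) (b i) = 0 := rfl
    rw [hD, hA, hB, hG0, sub_self, map_zero]
    erw [h0]
    simp
  simpa [h6] using h5

omit [FiniteDimensional ℝ EN] [T2Space N] in
-- The differentials of the `l i` remain a basis near `x`, and the coefficients are smooth because
-- inversion of linear maps is.
theorem exists_differential_eq_sum_smul {ι : Type*} [Fintype ι] {x : N}
    (b : Basis ι ℝ (CotangentSpace J x)) (l : ι → C^∞⟮J, N; 𝓘(ℝ), ℝ⟯)
    (hl : ∀ i, differential J (l i) x = b i) (f : C^∞⟮J, N; 𝓘(ℝ), ℝ⟯) :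
    ∃ c : ι → N → ℝ, (∀ i, ContMDiffAt J 𝓘(ℝ) ∞ (c i) x) ∧
      ∀ᶠ y in 𝓝 x, differential J f y = ∑ i, c i y • differential J (l i) y := by
  set φ := extChartAt J x with hφ
  let b' : Basis ι ℝ (EN →L[ℝ] ℝ) := b
  let d : C^∞⟮J, N; 𝓘(ℝ), ℝ⟯ → EN → EN →L[ℝ] ℝ := fun h ↦ fderiv ℝ (h ∘ φ.symm)
  have hd : ∀ h, ContDiffAt ℝ ∞ (d h) (φ x) := fun h ↦
    ((contMDiffOn_comp_extChartAt_symm h x).contDiffOn.contDiffAt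
      (extChartAt_target_mem_nhds (I := J) x)).fderiv_right (by simp)
  let A : EN → (ι → ℝ) →L[ℝ] (EN →L[ℝ] ℝ) := fun y ↦
    ∑ i, (ContinuousLinearMap.proj (R := ℝ) (φ := fun _ : ι ↦ ℝ) i).smulRight (d (l i) y)
  have hA : ContDiffAt ℝ ∞ A (φ x) :=
    ContDiffAt.sum fun i _ ↦ contDiffAt_const.smulRight (hd (l i))
  let e : (ι → ℝ) ≃L[ℝ] (EN →L[ℝ] ℝ) := b'.equivFun.symm.toContinuousLinearEquiv
  have hAe : A (φ x) = e := by
    ext1 v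
    have h1 : e v = ∑ i, v i • b' i := b'.equivFun_symm_apply v
    rw [ContinuousLinearEquiv.coe_coe, h1]
    simp only [A, sum_apply, ContinuousLinearMap.smulRight_apply, ContinuousLinearMap.proj_apply]
    refine Finset.sum_congr rfl fun i _ ↦ ?_
    exact congrArg (v i • ·) ((differential_eq_fderiv (l i) x).symm.trans (hl i))
  -- `inverse` takes the value zero where `A y` is not invertible; invertibility near `φ x` follows
  -- from openness of the set of equivalences.
  let c : EN → ι → ℝ := fun y ↦ (A y).inverse (d f y)
  have hc : ContDiffAt ℝ ∞ c (φ x) := by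
    refine ContDiffAt.clm_apply ?_ (hd f)
    have h1 : ContDiffAt ℝ ∞ ContinuousLinearMap.inverse (A (φ x)) := by
      rw [hAe]; exact contDiffAt_map_inverse e
    exact h1.comp _ hA
  have hev : ∀ᶠ y in 𝓝 (φ x), A y (c y) = d f y := by
    have h1 : range ((↑) : ((ι → ℝ) ≃L[ℝ] (EN →L[ℝ] ℝ)) → _) ∈ 𝓝 (A (φ x)) := by
      rw [hAe]; exact e.nhds
    filter_upwards [hA.continuousAt.eventually h1] with y ⟨e', he'⟩
    simp only [c, ← he', ContinuousLinearMap.inverse_equiv]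
    exact e'.apply_symm_apply _
  refine ⟨fun i ↦ (fun y ↦ c y i) ∘ φ, fun i ↦ ?_, ?_⟩
  · exact (contDiffAt_pi.1 hc i).contMDiffAt.comp x (contMDiffAt_extChartAt (I := J))
  · filter_upwards [(continuousAt_extChartAt (I := J) x).eventually hev,
      extChartAt_source_mem_nhds (I := J) x] with y hy hy'
    rw [differential_eq_fderiv_comp f hy']
    change (d f (φ y)).comp _ = _
    rw [← hy]
    simp only [A, sum_apply, ContinuousLinearMap.smulRight_apply, ContinuousLinearMap.proj_apply]
    have key (a : ι → ℝ) (B : ι → EN →L[ℝ] ℝ) (T : TangentSpace J y →L[ℝ] EN) :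
        (∑ i, a i • B i).comp T = ∑ i, a i • (B i).comp T := by
      simp [ContinuousLinearMap.finsetSum_comp]
    refine (key _ _ _).trans (Finset.sum_congr rfl fun i _ ↦ ?_)
    rw [differential_eq_fderiv_comp (l i) hy']
    rfl

end Bump

end SmoothFunctions

/-! ### Poisson brackets and families of functions with spanning differentials. -/

section PoissonGeneral

open Set Filter Topology

universe u

variable {EN : Type u} [NormedAddCommGroup EN] [NormedSpace ℝ EN]
  {HN : Type*} [TopologicalSpace HN] {J : ModelWithCorners ℝ EN HN}
  {N : Type*} [TopologicalSpace N] [ChartedSpace HN N]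

namespace PoissonStructure

variable (P : PoissonStructure J N)

theorem bracket_self (f : C^∞⟮J, N; 𝓘(ℝ), ℝ⟯) : P.bracket f f = 0 := by
  ext x
  have h := DFunLike.congr_fun (P.skew f f) x
  rw [ContMDiffMap.coe_neg, Pi.neg_apply] at h
  exact self_eq_neg.1 h

theorem leibniz_left (f g h : C^∞⟮J, N; 𝓘(ℝ), ℝ⟯) :
    P.bracket (f * g) h = f * P.bracket g h + P.bracket f h * g := by
  rw [P.skew, P.leibniz, P.skew h f, P.skew h g]
  ring

/-- The Jacobiator as a function of its last argument. -/
def jacobiator (B : C^∞⟮J, N; 𝓘(ℝ), ℝ⟯ →ₗ[ℝ] C^∞⟮J, N; 𝓘(ℝ), ℝ⟯ →ₗ[ℝ] C^∞⟮J, N; 𝓘(ℝ), ℝ⟯)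
    (f g : C^∞⟮J, N; 𝓘(ℝ), ℝ⟯) : C^∞⟮J, N; 𝓘(ℝ), ℝ⟯ →ₗ[ℝ] C^∞⟮J, N; 𝓘(ℝ), ℝ⟯ :=
  B f ∘ₗ B g - B (B f g) - B g ∘ₗ B f

end PoissonStructure

/-- Evaluation of smooth functions at a point, as a linear map. -/
def evalₗ (x : N) : C^∞⟮J, N; 𝓘(ℝ), ℝ⟯ →ₗ[ℝ] ℝ where
  toFun f := f x
  map_add' _ _ := rfl
  map_smul' _ _ := rfl

@[simp]
theorem evalₗ_apply (x : N) (f : C^∞⟮J, N; 𝓘(ℝ), ℝ⟯) : evalₗ x f = f x := rfl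

variable [FiniteDimensional ℝ EN] [T2Space N] [IsManifold J ∞ N] [J.Boundaryless]

theorem derivation_apply_congr {D : C^∞⟮J, N; 𝓘(ℝ), ℝ⟯ →ₗ[ℝ] C^∞⟮J, N; 𝓘(ℝ), ℝ⟯}
    (hD : ∀ f g, D (f * g) = D f * g + f * D g) {x : N} {f g : C^∞⟮J, N; 𝓘(ℝ), ℝ⟯}
    (h : differential J f x = differential J g x) : D f x = D g x := by
  have h1 := derivation_eq_zero_of_differential_eq_zero (x := x) (f := f - g) (evalₗ x ∘ₗ D)
    (fun f g ↦ by simp [hD]) (by rw [differential_sub, h, sub_self])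
  rw [map_sub, sub_eq_zero] at h1
  exact h1

namespace PoissonStructure

variable (P : PoissonStructure J N)

theorem bracket_apply_congr {x : N} {f f' g g' : C^∞⟮J, N; 𝓘(ℝ), ℝ⟯}
    (hf : differential J f x = differential J f' x)
    (hg : differential J g x = differential J g' x) :
    P.bracket f g x = P.bracket f' g' x := by
  rw [derivation_apply_congr (P.leibniz f) hg, P.skew, P.skew f']
  simp only [ContMDiffMap.coe_neg, Pi.neg_apply]
  rw [derivation_apply_congr (P.leibniz g') hf]

/-- A Poisson structure is determined by its values on functions whose differentials span. -/
theorem eq_of_bracket_eq {L : Type*} {D : L → C^∞⟮J, N; 𝓘(ℝ), ℝ⟯}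
    (hspan : ∀ (x : N) (α : CotangentSpace J x), ∃ l, differential J (D l) x = α)
    {P Q : PoissonStructure J N} (h : ∀ l l', P.bracket (D l) (D l') = Q.bracket (D l) (D l')) :
    P = Q := by
  ext f g x
  obtain ⟨l, hl⟩ := hspan x (differential J f x)
  obtain ⟨l', hl'⟩ := hspan x (differential J g x)
  rw [P.bracket_apply_congr hl.symm hl'.symm, Q.bracket_apply_congr hl.symm hl'.symm, h]

/-- Any two covectors at a point are proportional, and the bracket is skew. -/
theorem bracket_eq_zero_of_finrank_le_one (h : finrank ℝ EN ≤ 1) (f g : C^∞⟮J, N; 𝓘(ℝ), ℝ⟯) :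
    P.bracket f g = 0 := by
  ext x
  have hfr : finrank ℝ (CotangentSpace J x) ≤ 1 := by
    have h1 : finrank ℝ (EN →L[ℝ] ℝ) = finrank ℝ EN := by
      rw [← (LinearMap.toContinuousLinearMap (𝕜 := ℝ) (E := EN) (F' := ℝ)).finrank_eq]
      exact Subspace.dual_finrank_eq
    exact h1.trans_le h
  by_cases hf : differential J f x = 0
  · rw [P.bracket_apply_congr (f' := 0) (g' := g) (by rw [hf, differential_zero]) rfl]
    simp
  · have : FiniteDimensional ℝ (CotangentSpace J x) :=
      inferInstanceAs (FiniteDimensional ℝ (EN →L[ℝ] ℝ))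
    obtain ⟨v, hv⟩ := finrank_le_one_iff.1 hfr
    obtain ⟨a, ha⟩ := hv (differential J f x)
    obtain ⟨b, hb⟩ := hv (differential J g x)
    have ha0 : a ≠ 0 := by
      rintro rfl
      exact hf (by rw [← ha, zero_smul])
    have hg : differential J g x = differential J ((b / a) • f) x := by
      rw [differential_smul, ← ha, ← hb, smul_smul, div_mul_cancel₀ _ ha0]
    rw [P.bracket_apply_congr rfl hg, map_smul, P.bracket_self]
    simp

/-- The Jacobiator is alternating and a derivation in its last slot, hence depends on each argument
only through its differential. The arguments can thus be replaced by members of the family one at a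
time. -/
theorem jacobiator_eq_zero
    {B : C^∞⟮J, N; 𝓘(ℝ), ℝ⟯ →ₗ[ℝ] C^∞⟮J, N; 𝓘(ℝ), ℝ⟯ →ₗ[ℝ] C^∞⟮J, N; 𝓘(ℝ), ℝ⟯}
    (hskew : ∀ f g, B f g = -B g f) (hleib : ∀ f g h, B f (g * h) = B f g * h + g * B f h)
    {L : Type*} {D : L → C^∞⟮J, N; 𝓘(ℝ), ℝ⟯}
    (hspan : ∀ (x : N) (α : CotangentSpace J x), ∃ l, differential J (D l) x = α)
    (hjac : ∀ l l' l'', jacobiator B (D l) (D l') (D l'') = 0) (f g h : C^∞⟮J, N; 𝓘(ℝ), ℝ⟯) :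
    jacobiator B f g h = 0 := by
  have h12 : ∀ f g h, jacobiator B f g h = -jacobiator B g f h := fun f g h ↦ by
    simp only [jacobiator, LinearMap.sub_apply, LinearMap.comp_apply]
    rw [hskew g f, map_neg, LinearMap.neg_apply]
    abel
  have h23 : ∀ f g h, jacobiator B f g h = -jacobiator B f h g := fun f g h ↦ by
    simp only [jacobiator, LinearMap.sub_apply, LinearMap.comp_apply]
    rw [hskew h g, hskew h (B f g), hskew (B f h) g, map_neg]
    abel
  -- The mixed products of first brackets cancel, leaving a first-order operator.
  have hder : ∀ f g h k, jacobiator B f g (h * k) =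
      jacobiator B f g h * k + h * jacobiator B f g k := fun f g h k ↦ by
    simp only [jacobiator, LinearMap.sub_apply, LinearMap.comp_apply, hleib, map_add]
    ring
  have key : ∀ (x : N) f g h, ∃ l, jacobiator B f g h x = jacobiator B f g (D l) x :=
    fun x f g h ↦ by
      obtain ⟨l, hl⟩ := hspan x (differential J h x)
      exact ⟨l, derivation_apply_congr (hder f g) hl.symm⟩
  ext x
  obtain ⟨l, hl⟩ := key x f g h
  rw [hl, h23]
  obtain ⟨l', hl'⟩ := key x f (D l) g
  rw [ContMDiffMap.coe_neg, Pi.neg_apply, hl', h12]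
  obtain ⟨l'', hl''⟩ := key x (D l) (D l') f
  rw [ContMDiffMap.coe_neg, Pi.neg_apply, h23, ContMDiffMap.coe_neg, Pi.neg_apply, hl'', hjac]
  simp

end PoissonStructure

/-- A bilinear alternating form as an alternating map on two variables. -/
def alternatingMapOfBilinear {V : Type*} [AddCommGroup V] [Module ℝ V]
    {B : V →ₗ[ℝ] V →ₗ[ℝ] ℝ} (hB : ∀ v, B v v = 0) : V [⋀^Fin 2]→ₗ[ℝ] ℝ where
  toFun v := B (v 0) (v 1)
  map_update_add' v i a b := by
    fin_cases i <;> simp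
  map_update_smul' v i c a := by
    fin_cases i <;> simp
  map_eq_zero_of_eq' v i j h hij := by
    fin_cases i <;> fin_cases j <;> simp_all

omit [T2Space N] in
-- Near a point both differentials are smooth combinations of finitely many members of the family,
-- so the form on them is a smooth combination of functions known to be smooth.
theorem contMDiff_bilinear_differential
    {B : ∀ x : N, CotangentSpace J x →ₗ[ℝ] CotangentSpace J x →ₗ[ℝ] ℝ}
    {L : Type*} {D : L → C^∞⟮J, N; 𝓘(ℝ), ℝ⟯}
    (hspan : ∀ (x : N) (α : CotangentSpace J x), ∃ l, differential J (D l) x = α)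
    (hB : ∀ l l', ContMDiff J 𝓘(ℝ) ∞
      fun x ↦ B x (differential J (D l) x) (differential J (D l') x))
    (f g : C^∞⟮J, N; 𝓘(ℝ), ℝ⟯) :
    ContMDiff J 𝓘(ℝ) ∞ fun x ↦ B x (differential J f x) (differential J g x) := by
  intro x
  have : FiniteDimensional ℝ (CotangentSpace J x) :=
    inferInstanceAs (FiniteDimensional ℝ (EN →L[ℝ] ℝ))
  let b := finBasis ℝ (CotangentSpace J x)
  choose l hl using fun i ↦ hspan x (b i)
  obtain ⟨c, hc, hcf⟩ := exists_differential_eq_sum_smul b (fun i ↦ D (l i)) hl f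
  obtain ⟨c', hc', hcg⟩ := exists_differential_eq_sum_smul b (fun i ↦ D (l i)) hl g
  have h1 : ContMDiffAt J 𝓘(ℝ) ∞ (fun y ↦ ∑ i, ∑ j, c i y * (c' j y *
      B y (differential J (D (l i)) y) (differential J (D (l j)) y))) x :=
    contMDiffAt_finsetSum fun i _ ↦ contMDiffAt_finsetSum fun j _ ↦
      (hc i).mul ((hc' j).mul (hB _ _ x))
  refine h1.congr_of_eventuallyEq ?_
  filter_upwards [hcf, hcg] with y hf hg
  rw [hf, hg]
  simp only [map_sum, map_smul, LinearMap.sum_apply, LinearMap.smul_apply, smul_eq_mul,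
    Finset.mul_sum]
  rw [Finset.sum_comm]
  exact Finset.sum_congr rfl fun i _ ↦ Finset.sum_congr rfl fun j _ ↦ by ring

/-- A Lie bracket on a space of functions whose differentials span extends to a Poisson bracket,
provided that its value at a point only depends on the differentials. -/
theorem exists_poissonStructure {L : Type*} [AddCommGroup L] [Module ℝ L]
    (D : L →ₗ[ℝ] C^∞⟮J, N; 𝓘(ℝ), ℝ⟯) (β : L →ₗ[ℝ] L →ₗ[ℝ] L) (hβ : ∀ l, β l l = 0)
    (hspan : ∀ (x : N) (α : CotangentSpace J x), ∃ l, differential J (D l) x = α)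
    (hker : ∀ x l, differential J (D l) x = 0 → ∀ l', D (β l l') x = 0)
    (hjac : ∀ l l' l'', D (β l (β l' l'')) = D (β (β l l') l'') + D (β l' (β l l''))) :
    ∃ (P : PoissonStructure J N) (u : MultivectorField J N 2),
      PoissonStructure.HasBivector J P u ∧ ∀ l l', P.bracket (D l) (D l') = D (β l l') := by
  have hskew : ∀ l l', β l l' = -β l' l := fun l l' ↦ by
    have := hβ (l + l')
    simp only [map_add, LinearMap.add_apply, hβ, zero_add, add_zero] at this
    exact eq_neg_of_add_eq_zero_right this
  -- A linear right inverse is chosen at each point with no regularity in `x`: by `hker` and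
  -- skew-symmetry the resulting form does not depend on the choice.
  have hs : ∀ x : N, ∃ s : CotangentSpace J x →ₗ[ℝ] L,
      ∀ α, differential J (D (s α)) x = α := fun x ↦ by
    obtain ⟨s, hs⟩ := (differentialₗ J x ∘ₗ D).exists_rightInverse_of_surjective
      (LinearMap.range_eq_top.2 (hspan x))
    exact ⟨s, fun α ↦ DFunLike.congr_fun hs α⟩
  choose s hs using hs
  let B : ∀ x : N, CotangentSpace J x →ₗ[ℝ] CotangentSpace J x →ₗ[ℝ] ℝ := fun x ↦
    ((β.compl₁₂ (s x) (s x)).compr₂ D).compr₂ (evalₗ x)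
  have hB : ∀ x α α', B x α α' = D (β (s x α) (s x α')) x := fun x α α' ↦ rfl
  have hBalt : ∀ x α, B x α α = 0 := fun x α ↦ by rw [hB, hβ, map_zero]; rfl
  have hcongr : ∀ x l₁ l₂ l', differential J (D l₁) x = differential J (D l₂) x →
      D (β l₁ l') x = D (β l₂ l') x := fun x l₁ l₂ l' h ↦ by
    have := hker x (l₁ - l₂) (by rw [map_sub, differential_sub, h, sub_self]) l'
    rw [map_sub, LinearMap.sub_apply, map_sub] at this
    exact sub_eq_zero.1 this
  have hBD : ∀ x l l', B x (differential J (D l) x) (differential J (D l') x) = D (β l l') x := by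
    intro x l l'
    rw [hB, hcongr x _ l _ (hs x _), hskew, map_neg, hskew l, map_neg]
    simp only [ContMDiffMap.coe_neg, Pi.neg_apply]
    rw [hcongr x _ l' _ (hs x _)]
  have hsmooth := contMDiff_bilinear_differential (B := B) (D := D) hspan
    (fun l l' ↦ (D (β l l')).contMDiff.congr fun x ↦ hBD x l l')
  let br : C^∞⟮J, N; 𝓘(ℝ), ℝ⟯ →ₗ[ℝ] C^∞⟮J, N; 𝓘(ℝ), ℝ⟯ →ₗ[ℝ] C^∞⟮J, N; 𝓘(ℝ), ℝ⟯ :=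
    LinearMap.mk₂ ℝ (fun f g ↦ ⟨_, hsmooth f g⟩)
      (fun f f' g ↦ ContMDiffMap.ext fun x ↦ by
        change B x _ _ = B x _ _ + B x _ _
        rw [differential_add, map_add, LinearMap.add_apply])
      (fun c f g ↦ ContMDiffMap.ext fun x ↦ by
        change B x _ _ = c • B x _ _
        rw [differential_smul, map_smul, LinearMap.smul_apply])
      (fun f g g' ↦ ContMDiffMap.ext fun x ↦ by
        change B x _ _ = B x _ _ + B x _ _
        rw [differential_add, map_add])
      (fun c f g ↦ ContMDiffMap.ext fun x ↦ by
        change B x _ _ = c • B x _ _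
        rw [differential_smul, map_smul])
  have hbr : ∀ f g x, br f g x = B x (differential J f x) (differential J g x) :=
    fun f g x ↦ rfl
  have hbrD : ∀ l l', br (D l) (D l') = D (β l l') := fun l l' ↦ by
    ext x
    rw [hbr, hBD]
  have hbrskew : ∀ f g, br f g = -br g f := fun f g ↦ by
    ext x
    rw [ContMDiffMap.coe_neg, Pi.neg_apply, hbr, hbr, hB, hB, hskew, map_neg]
    rfl
  have hbrleib : ∀ f g h, br f (g * h) = br f g * h + g * br f h := fun f g h ↦ by
    ext x
    simp only [ContMDiffMap.coe_add, ContMDiffMap.coe_mul, Pi.add_apply, Pi.mul_apply, hbr]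
    rw [differential_mul, map_add, map_smul, map_smul, smul_eq_mul, smul_eq_mul]
    ring
  refine ⟨⟨br, hbrskew, hbrleib, fun f g h ↦ ?_⟩,
    fun x ↦ alternatingMapOfBilinear (hBalt x), fun f g x ↦ rfl, hbrD⟩
  have h1 := PoissonStructure.jacobiator_eq_zero hbrskew hbrleib (D := D) hspan
    (fun l l' l'' ↦ by
      simp only [PoissonStructure.jacobiator, LinearMap.sub_apply, LinearMap.comp_apply, hbrD]
      rw [hjac]
      abel) f g h
  simp only [PoissonStructure.jacobiator, LinearMap.sub_apply, LinearMap.comp_apply] at h1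
  rw [sub_sub, sub_eq_zero] at h1
  exact h1

end PoissonGeneral

/-! ### Global sections, cutoffs and local frames of a vector bundle. -/

section Sections

open Set Filter Topology

variable {EM : Type*} [NormedAddCommGroup EM] [NormedSpace ℝ EM]
  {HM : Type*} [TopologicalSpace HM] {I : ModelWithCorners ℝ EM HM}
  {M : Type*} [TopologicalSpace M] [ChartedSpace HM M]
  {F : Type*} [NormedAddCommGroup F] [NormedSpace ℝ F]
  {E : M → Type*} [TopologicalSpace (TotalSpace F E)]
  [∀ x, AddCommGroup (E x)] [∀ x, Module ℝ (E x)] [∀ x, TopologicalSpace (E x)]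
  [FiberBundle F E] [VectorBundle ℝ F E]

omit [∀ x, AddCommGroup (E x)] [∀ x, Module ℝ (E x)] [NormedSpace ℝ F] [VectorBundle ℝ F E] in
-- Points of one fiber are separated in a trivialization, all others in the base. The pointwise
-- theory of derivations needs this on the total space.
theorem t2Space_totalSpace [T2Space M] : T2Space (TotalSpace F E) := by
  refine ⟨fun v w hvw ↦ ?_⟩
  by_cases h : v.proj = w.proj
  · let e := trivializationAt F E v.proj
    have hv : v ∈ e.source := e.mem_source.2 (mem_baseSet_trivializationAt F E v.proj)
    have hw : w ∈ e.source := e.mem_source.2 (h ▸ mem_baseSet_trivializationAt F E v.proj)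
    have he : (e v).2 ≠ (e w).2 := fun h2 ↦ hvw (e.injOn hv hw
      (Prod.ext ((e.coe_fst hv).trans (h.trans (e.coe_fst hw).symm)) h2))
    obtain ⟨U, V, hU, hV, hvU, hwV, hUV⟩ := t2_separation he
    have hc : ContinuousOn (fun z ↦ (e z).2) e.source := continuous_snd.comp_continuousOn
      e.continuousOn
    refine ⟨e.source ∩ (fun z ↦ (e z).2) ⁻¹' U, e.source ∩ (fun z ↦ (e z).2) ⁻¹' V,
      hc.isOpen_inter_preimage e.open_source hU, hc.isOpen_inter_preimage e.open_source hV,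
      ⟨hv, hvU⟩, ⟨hw, hwV⟩, ?_⟩
    exact (hUV.preimage _).mono inter_subset_right inter_subset_right
  · obtain ⟨U, V, hU, hV, hvU, hwV, hUV⟩ := t2_separation h
    have hc := FiberBundle.continuous_proj F E
    exact ⟨_, _, hU.preimage hc, hV.preimage hc, hvU, hwV, hUV.preimage _⟩

@[simp]
theorem ContMDiffSection.funSMul_apply (f : C^∞⟮I, M; 𝓘(ℝ), ℝ⟯) (σ : Cₛ^∞⟮I; F, E⟯) (x : M) :
    ContMDiffSection.funSMul f σ x = f x • σ x := rfl

theorem ContMDiffSection.sum_apply {ι : Type*} (s : Finset ι) (σ : ι → Cₛ^∞⟮I; F, E⟯) (x : M) :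
    (∑ i ∈ s, σ i) x = ∑ i ∈ s, σ i x := by
  let ev : Cₛ^∞⟮I; F, E⟯ →+ E x :=
    { toFun := fun σ ↦ σ x, map_zero' := rfl, map_add' := fun _ _ ↦ rfl }
  exact map_sum ev σ s

theorem ContMDiffMap.sum_apply {ι : Type*} (s : Finset ι) (f : ι → C^∞⟮I, M; 𝓘(ℝ), ℝ⟯) (x : M) :
    (∑ i ∈ s, f i) x = ∑ i ∈ s, f i x :=
  map_sum (evalₗ x) f s

variable [ContMDiffVectorBundle ∞ F E I]

theorem Bundle.Trivialization.contMDiffOn_symm_section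
    (e : Trivialization F (TotalSpace.proj : TotalSpace F E → M)) [MemTrivializationAtlas e]
    (w : F) :
    ContMDiffOn I (I.prod 𝓘(ℝ, F)) ∞ (fun x ↦ TotalSpace.mk' F x (e.symm x w)) e.baseSet := by
  rw [e.contMDiffOn_section_baseSet_iff]
  exact contMDiffOn_const.congr fun x hx ↦ by rw [e.apply_mk_symm hx]

omit [ContMDiffVectorBundle ∞ F E I] in
theorem exists_section_eq_smul {χ : C^∞⟮I, M; 𝓘(ℝ), ℝ⟯} {s : Set M} (hs : IsOpen s)
    (hχ : tsupport χ ⊆ s) {τ : ∀ x, E x}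
    (hτ : ContMDiffOn I (I.prod 𝓘(ℝ, F)) ∞ (fun x ↦ TotalSpace.mk' F x (τ x)) s) :
    ∃ σ : Cₛ^∞⟮I; F, E⟯, ∀ x, σ x = χ x • τ x :=
  ⟨⟨_, ContMDiffOn.smul_section_of_tsupport χ.contMDiff.contMDiffOn hs hχ hτ⟩, fun _ ↦ rfl⟩

omit [ContMDiffVectorBundle ∞ F E I] in
theorem contMDiff_fiberScaling (t : ℝ) :
    ContMDiff (I.prod 𝓘(ℝ, F)) (I.prod 𝓘(ℝ, F)) ∞ (fiberScaling F t : TotalSpace F E → _) := by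
  intro v
  have h := contMDiffAt_totalSpace.1 (contMDiff_id (I := I.prod 𝓘(ℝ, F)) (n := ∞) v)
  rw [contMDiffAt_totalSpace]
  refine ⟨h.1, ?_⟩
  have h2 : ContMDiffAt (I.prod 𝓘(ℝ, F)) 𝓘(ℝ, F) ∞
      (fun w : TotalSpace F E ↦ t • (trivializationAt F E v.proj w).2) v :=
    (t • ContinuousLinearMap.id ℝ F).contMDiff.contMDiffAt.comp v h.2
  refine h2.congr_of_eventuallyEq ?_
  have hopen := (trivializationAt F E v.proj).open_source.mem_nhds
    ((trivializationAt F E v.proj).mem_source.2 (mem_baseSet_trivializationAt F E v.proj))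
  filter_upwards [hopen] with w hw
  exact ((trivializationAt F E v.proj).linear ℝ
    ((trivializationAt F E v.proj).mem_source.1 hw)).map_smul t w.2

/-- Smoothness of the inclusion of a fiber, parametrized by the model fiber, allows functions on the
total space to be restricted to fibers. -/
theorem contMDiff_mk_symm (x : M) :
    ContMDiff 𝓘(ℝ, F) (I.prod 𝓘(ℝ, F)) ∞
      (fun w : F ↦ TotalSpace.mk' F x ((trivializationAt F E x).symm x w)) := by
  have hx := mem_baseSet_trivializationAt F E x
  intro w
  rw [(trivializationAt F E x).contMDiffAt_iff
    ((trivializationAt F E x).mem_source.2 hx)]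
  refine ⟨contMDiffAt_const, contMDiffAt_id.congr_of_eventuallyEq (Eventually.of_forall ?_)⟩
  intro w'
  simp only [(trivializationAt F E x).apply_mk_symm hx, id]

section Extension

variable [FiniteDimensional ℝ EM] [T2Space M] [IsManifold I ∞ M]

theorem exists_section_eventuallyEq_symm (x : M) (w : F) :
    ∃ σ : Cₛ^∞⟮I; F, E⟯, ∀ᶠ y in 𝓝 x, σ y = (trivializationAt F E x).symm y w := by
  have hx := mem_baseSet_trivializationAt F E x
  have ho := (trivializationAt F E x).open_baseSet
  obtain ⟨χ, h1, hχ⟩ := exists_contMDiffMap_eventuallyEq_one (J := I) (ho.mem_nhds hx)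
  obtain ⟨σ, hσ⟩ := exists_section_eq_smul ho hχ
    ((trivializationAt F E x).contMDiffOn_symm_section (I := I) w)
  exact ⟨σ, h1.mono fun y hy ↦ by rw [hσ, hy, Pi.one_apply, one_smul]⟩

variable (I F) in
theorem exists_section_apply_eq (x : M) (v : E x) : ∃ σ : Cₛ^∞⟮I; F, E⟯, σ x = v := by
  obtain ⟨σ, hσ⟩ := exists_section_eventuallyEq_symm (I := I) (E := E) x
    (trivializationAt F E x ⟨x, v⟩).2
  refine ⟨σ, hσ.self_of_nhds.trans ?_⟩
  exact (trivializationAt F E x).symm_apply_apply_mk (mem_baseSet_trivializationAt F E x) v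

variable (I F E) in
-- A global substitute for a local frame: with a cutoff `χ`, one has `σ = (1 - χ²) σ + ∑ (χ σⁱ) (χ
-- eᵢ)`. The remainder coefficient vanishes near `x`, so it is invisible to first-order operators at
-- `x`.
theorem exists_section_frame [FiniteDimensional ℝ F] (x : M) :
    ∃ s : Fin (finrank ℝ F) → Cₛ^∞⟮I; F, E⟯, ∀ σ : Cₛ^∞⟮I; F, E⟯,
      ∃ (g : C^∞⟮I, M; 𝓘(ℝ), ℝ⟯) (f : Fin (finrank ℝ F) → C^∞⟮I, M; 𝓘(ℝ), ℝ⟯),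
        g x = 0 ∧ differential I g x = 0 ∧ (σ x = 0 → ∀ i, f i x = 0) ∧
        σ = ContMDiffSection.funSMul g σ + ∑ i, ContMDiffSection.funSMul (f i) (s i) := by
  set e := trivializationAt F E x with he
  have hx : x ∈ e.baseSet := mem_baseSet_trivializationAt F E x
  obtain ⟨χ, h1, hχ⟩ := exists_contMDiffMap_eventuallyEq_one (J := I) (e.open_baseSet.mem_nhds hx)
  let b := finBasis ℝ F
  choose s hs using fun i ↦ exists_section_eq_smul e.open_baseSet hχ
    (e.contMDiffOn_localFrame_baseSet (I := I) ∞ b i)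
  refine ⟨s, fun σ ↦ ?_⟩
  choose f hf using fun i ↦ exists_contMDiffMap_eq_mul e.open_baseSet hχ
    (contMDiffOn_baseSet_localFrameCoeff b (e := e) σ.contMDiff.contMDiffOn i)
  refine ⟨1 - χ * χ, f, ?_, ?_, fun h i ↦ ?_, ?_⟩
  · change 1 - χ x * χ x = 0
    rw [h1.self_of_nhds]
    simp
  · rw [← differential_zero x]
    refine differential_congr (h1.mono fun y hy ↦ ?_)
    change 1 - χ y * χ y = 0
    rw [hy]
    simp
  · rw [hf]
    simp [h]
  · ext y
    simp only [ContMDiffSection.coe_add, Pi.add_apply, ContMDiffSection.sum_apply,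
      ContMDiffSection.funSMul_apply, hf, hs]
    change σ y = (1 - χ y * χ y) • σ y + _
    by_cases hy : y ∈ e.baseSet
    · have h3 := e.eq_sum_localFrameCoeff_smul (I := I) (b := b) (s := σ) hy
      have h4 : ∑ i, (χ y * (LinearMap.piApply (e.localFrameCoeff I b i)) σ y) •
          χ y • e.localFrame b i y = (χ y * χ y) • σ y := by
        conv_rhs => rw [h3]
        rw [Finset.smul_sum]
        refine Finset.sum_congr rfl fun i _ ↦ ?_
        rw [smul_smul, smul_smul]
        congr 1
        simp only [LinearMap.piApply_apply]
        ring
      rw [h4]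
      module
    · have h0 : χ y = 0 := image_eq_zero_of_notMem_tsupport fun h ↦ hy (hχ h)
      simp [h0]

end Extension

end Sections

/-! ### A smoothness criterion for bundle maps. -/

section Criteria

open Set Filter Topology

universe u

variable {EM : Type u} [NormedAddCommGroup EM] [NormedSpace ℝ EM]
  {HM : Type*} [TopologicalSpace HM] {I : ModelWithCorners ℝ EM HM}
  {M : Type*} [TopologicalSpace M] [ChartedSpace HM M]
  {F : Type*} [NormedAddCommGroup F] [NormedSpace ℝ F]
  {E : M → Type*} [TopologicalSpace (TotalSpace F E)]
  [∀ x, AddCommGroup (E x)] [∀ x, Module ℝ (E x)] [∀ x, TopologicalSpace (E x)]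
  [FiberBundle F E] [VectorBundle ℝ F E]
  {F' : Type*} [NormedAddCommGroup F'] [NormedSpace ℝ F']
  {E' : M → Type*} [TopologicalSpace (TotalSpace F' E')]
  [∀ x, AddCommGroup (E' x)] [∀ x, Module ℝ (E' x)] [∀ x, TopologicalSpace (E' x)]
  [∀ x, IsTopologicalAddGroup (E' x)] [∀ x, ContinuousSMul ℝ (E' x)]
  [FiberBundle F' E'] [VectorBundle ℝ F' E']

theorem contMDiffAt_clm_of_apply [FiniteDimensional ℝ F] {T : M → F →L[ℝ] F'} {x : M}
    (h : ∀ w, ContMDiffAt I 𝓘(ℝ, F') ∞ (fun y ↦ T y w) x) :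
    ContMDiffAt I 𝓘(ℝ, F →L[ℝ] F') ∞ T x := by
  let b := finBasis ℝ F
  have h1 : T = fun y ↦ ∑ i, ContinuousLinearMap.smulRightL ℝ F F'
      (b.coord i).toContinuousLinearMap (T y (b i)) := by
    ext y w
    conv_lhs => rw [← b.sum_repr w]
    simp [-Basis.sum_repr]
  rw [h1]
  exact contMDiffAt_finsetSum fun i _ ↦
    (ContinuousLinearMap.smulRightL ℝ F F'
      (b.coord i).toContinuousLinearMap).contMDiff.contMDiffAt.comp x (h (b i))

variable [ContMDiffVectorBundle ∞ F E I] [ContMDiffVectorBundle ∞ F' E' I]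

omit [ContMDiffVectorBundle ∞ F' E' I] in
/-- A field of linear maps between fibers is smooth if it maps smooth sections to smooth ones. -/
theorem contMDiff_hom_of_apply_section [FiniteDimensional ℝ F] [FiniteDimensional ℝ EM]
    [T2Space M] [IsManifold I ∞ M] {a : ∀ x, E x →L[ℝ] E' x}
    (h : ∀ σ : Cₛ^∞⟮I; F, E⟯,
      ContMDiff I (I.prod 𝓘(ℝ, F')) ∞ fun x ↦ TotalSpace.mk' F' x (a x (σ x))) :
    ContMDiff I (I.prod 𝓘(ℝ, F →L[ℝ] F')) ∞
      fun x ↦ TotalSpace.mk' (F →L[ℝ] F') (E := fun x ↦ E x →L[ℝ] E' x) x (a x) := by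
  intro x
  rw [contMDiffAt_hom_bundle]
  refine ⟨contMDiffAt_id, contMDiffAt_clm_of_apply fun w ↦ ?_⟩
  -- Sections that are constant in the trivialization near `x` recover the columns of the local
  -- matrix of `a`.
  obtain ⟨σ, hσ⟩ := exists_section_eventuallyEq_symm (I := I) (E := E) x w
  have h1 := (contMDiffAt_section x).1 (h σ x)
  refine h1.congr_of_eventuallyEq ?_
  filter_upwards [hσ, (trivializationAt F E x).open_baseSet.mem_nhds
    (mem_baseSet_trivializationAt F E x), (trivializationAt F' E' x).open_baseSet.mem_nhds
    (mem_baseSet_trivializationAt F' E' x)] with y hy hy' hy''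
  rw [hy]
  change (trivializationAt F' E' x).continuousLinearMapAt ℝ y
    (a y ((trivializationAt F E x).symmL ℝ y w)) = _
  rw [Trivialization.symmL_apply _ hy', Trivialization.continuousLinearMapAt_apply,
    Trivialization.coe_linearMapAt_of_mem _ hy'']

end Criteria

/-! ### Vector fields and their action on functions. -/

section TangentSections

open Set Filter Topology

universe u

variable {EM : Type u} [NormedAddCommGroup EM] [NormedSpace ℝ EM]
  {HM : Type*} [TopologicalSpace HM] {I : ModelWithCorners ℝ EM HM}
  {M : Type*} [TopologicalSpace M] [ChartedSpace HM M] [IsManifold I ∞ M] [I.Boundaryless]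

omit [I.Boundaryless] in
theorem trivializationAt_tangent_apply {x y : M} (hy : y ∈ (chartAt HM x).source)
    (v : TangentSpace I y) :
    (trivializationAt EM (TangentSpace I) x ⟨y, v⟩).2 =
      mfderiv I 𝓘(ℝ, EM) (extChartAt I x) y v := by
  have hy' : y ∈ (trivializationAt EM (TangentSpace I) x).baseSet := by simpa using hy
  have h := DFunLike.congr_fun (TangentBundle.continuousLinearMapAt_trivializationAt hy) v
  refine Eq.trans ?_ h
  rw [Trivialization.continuousLinearMapAt_apply, Trivialization.coe_linearMapAt_of_mem _ hy']

theorem contMDiff_differential_apply (f : C^∞⟮I, M; 𝓘(ℝ), ℝ⟯) {X : ∀ x : M, TangentSpace I x}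
    (hX : ContMDiff I (I.prod 𝓘(ℝ, EM)) ∞ fun x ↦ TotalSpace.mk' EM x (X x)) :
    ContMDiff I 𝓘(ℝ) ∞ fun x ↦ differential I f x (X x) := by
  intro x
  have h1 := (contMDiffAt_section x).1 (hX x)
  have h2 : ContDiffAt ℝ ∞ (fderiv ℝ (f ∘ (extChartAt I x).symm)) (extChartAt I x x) :=
    ((contMDiffOn_comp_extChartAt_symm f x).contDiffOn.contDiffAt
      (extChartAt_target_mem_nhds (I := I) x)).fderiv_right (by simp)
  have h3 := (h2.contMDiffAt.comp x (contMDiffAt_extChartAt (I := I))).clm_apply h1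
  refine h3.congr_of_eventuallyEq ?_
  filter_upwards [extChartAt_source_mem_nhds (I := I) x] with y hy
  rw [trivializationAt_tangent_apply (by simpa using hy), differential_eq_fderiv_comp f hy]
  rfl

omit [I.Boundaryless] in
-- The chart components of `X` near `x` are its derivatives of global functions that agree there
-- with the coordinates.
theorem contMDiff_of_differential_apply [FiniteDimensional ℝ EM] [T2Space M]
    {X : ∀ x : M, TangentSpace I x}
    (hX : ∀ f : C^∞⟮I, M; 𝓘(ℝ), ℝ⟯, ContMDiff I 𝓘(ℝ) ∞ fun x ↦ differential I f x (X x)) :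
    ContMDiff I (I.prod 𝓘(ℝ, EM)) ∞ fun x ↦ TotalSpace.mk' EM x (X x) := by
  intro x
  rw [contMDiffAt_section]
  let b := finBasis ℝ EM
  have hf : ∀ i, ∃ f : C^∞⟮I, M; 𝓘(ℝ), ℝ⟯,
      f =ᶠ[𝓝 x] (b.coord i).toContinuousLinearMap ∘ extChartAt I x := fun i ↦ by
    refine exists_contMDiffMap_eventuallyEq (extChartAt_source_mem_nhds (I := I) x)
      ((b.coord i).toContinuousLinearMap.contMDiff.comp_contMDiffOn ?_)
    rw [extChartAt_source]
    exact contMDiffOn_extChartAt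
  choose f hf using hf
  have h1 : ContMDiffAt I 𝓘(ℝ, EM) ∞ (fun y ↦ ∑ i, differential I (f i) y (X y) • b i) x :=
    contMDiffAt_finsetSum fun i _ ↦
      (((ContinuousLinearMap.id ℝ ℝ).smulRight (b i)).contMDiff.contMDiffAt.comp x (hX (f i) x))
  refine h1.congr_of_eventuallyEq ?_
  have hf' := eventually_all.2 fun i ↦ (hf i).eventuallyEq_nhds
  filter_upwards [extChartAt_source_mem_nhds (I := I) x, hf'] with y hy hfy
  have hy' : y ∈ (chartAt HM x).source := by simpa using hy
  rw [trivializationAt_tangent_apply hy']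
  conv_lhs => rw [← b.sum_repr (mfderiv I 𝓘(ℝ, EM) (extChartAt I x) y (X y))]
  refine Finset.sum_congr rfl fun i _ ↦ ?_
  congr 1
  have h2 := (hfy i).mfderiv_eq (I := I) (I' := 𝓘(ℝ))
  rw [mfderiv_comp y (b.coord i).toContinuousLinearMap.mdifferentiableAt
    (mdifferentiableAt_extChartAt hy'), ContinuousLinearMap.mfderiv_eq] at h2
  exact (DFunLike.congr_fun h2 (X y)).symm

end TangentSections

/-! ### Duality between tangent vectors and differentials. -/

section Separating

universe u

variable {EN : Type u} [NormedAddCommGroup EN] [NormedSpace ℝ EN] [FiniteDimensional ℝ EN]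
  {HN : Type*} [TopologicalSpace HN] {J : ModelWithCorners ℝ EN HN}
  {N : Type*} [TopologicalSpace N] [ChartedSpace HN N]

theorem exists_differential_eq_of_separating {L : Type*} [AddCommGroup L] [Module ℝ L]
    (D : L →ₗ[ℝ] C^∞⟮J, N; 𝓘(ℝ), ℝ⟯) {x : N}
    (h : ∀ v : TangentSpace J x, (∀ l, differential J (D l) x v = 0) → v = 0)
    (α : CotangentSpace J x) : ∃ l, differential J (D l) x = α := by
  suffices hr : (differentialₗ J x ∘ₗ D).range = ⊤ from LinearMap.range_eq_top.1 hr α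
  by_contra hne
  obtain ⟨φ, hφ0, hφ⟩ := Submodule.exists_le_ker_of_lt_top _ (lt_top_iff_ne_top.2 hne)
  -- A functional vanishing on all the available differentials is, by reflexivity, evaluation at a
  -- tangent vector; that vector is zero by hypothesis.
  let ψ : Dual ℝ (Dual ℝ EN) := φ ∘ₗ (LinearMap.toContinuousLinearMap (E := EN) (F' := ℝ)).toLinearMap
  let v : EN := (evalEquiv ℝ EN).symm ψ
  have hv : ∀ β : EN →L[ℝ] ℝ, φ β = β v := fun β ↦ by
    have h1 : ψ (β : EN →ₗ[ℝ] ℝ) = (β : EN →ₗ[ℝ] ℝ) v :=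
      (apply_evalEquiv_symm_apply ℝ EN (β : EN →ₗ[ℝ] ℝ) ψ).symm
    exact h1
  have hv0 : v = 0 := h v fun l ↦ (hv _).symm.trans (hφ ⟨l, rfl⟩)
  exact hφ0 (LinearMap.ext fun β ↦ (hv β).trans (by rw [hv0]; exact map_zero β))

theorem eq_zero_of_differential_apply_eq_zero [T2Space N] [IsManifold J ∞ N] [J.Boundaryless]
    {x : N} {v : TangentSpace J x}
    (h : ∀ f : C^∞⟮J, N; 𝓘(ℝ), ℝ⟯, differential J f x v = 0) : v = 0 := by
  have h1 : ∀ α : EN →L[ℝ] ℝ, α v = 0 := fun α ↦ by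
    obtain ⟨f, hf⟩ := exists_differential_eq (J := J) x α
    rw [← hf]
    exact h f
  exact SeparatingDual.eq_zero_of_forall_dual_eq_zero (R := ℝ) (V := EN) h1

end Separating

/-! ### Fiber scaling and pullbacks from the base. -/

section TotalSpaceGeometry

open Set Filter Topology

variable {EM : Type*} [NormedAddCommGroup EM] [NormedSpace ℝ EM]
  {HM : Type*} [TopologicalSpace HM] {I : ModelWithCorners ℝ EM HM}
  {M : Type*} [TopologicalSpace M] [ChartedSpace HM M]
  {F : Type*} [NormedAddCommGroup F] [NormedSpace ℝ F]
  {E : M → Type*} [TopologicalSpace (TotalSpace F E)]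
  [∀ x, AddCommGroup (E x)] [∀ x, Module ℝ (E x)] [∀ x, TopologicalSpace (E x)]
  [FiberBundle F E] [VectorBundle ℝ F E]

variable (F E) in
/-- The pull-back of a smooth function on the base to the total space of a vector bundle. -/
def basePullback (f : C^∞⟮I, M; 𝓘(ℝ), ℝ⟯) :
    C^∞⟮I.prod 𝓘(ℝ, F), TotalSpace F E; 𝓘(ℝ), ℝ⟯ :=
  f.comp ⟨TotalSpace.proj, contMDiff_proj E⟩

@[simp]
theorem basePullback_apply (f : C^∞⟮I, M; 𝓘(ℝ), ℝ⟯) (v : TotalSpace F E) :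
    basePullback F E f v = f v.proj := rfl

theorem basePullback_add (f g : C^∞⟮I, M; 𝓘(ℝ), ℝ⟯) :
    basePullback F E (f + g) = basePullback F E f + basePullback F E g := rfl

theorem basePullback_smul (c : ℝ) (f : C^∞⟮I, M; 𝓘(ℝ), ℝ⟯) :
    basePullback F E (c • f) = c • basePullback F E f := rfl

theorem differential_basePullback (f : C^∞⟮I, M; 𝓘(ℝ), ℝ⟯) (v : TotalSpace F E) :
    differential (I.prod 𝓘(ℝ, F)) (basePullback F E f) v =
      (differential I f v.proj).comp (mfderiv (I.prod 𝓘(ℝ, F)) I TotalSpace.proj v) :=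
  differential_comp f ⟨TotalSpace.proj, contMDiff_proj E⟩ v

variable (I F E) in
/-- Scalar multiplication on the total space, as a smooth map. -/
def fiberScalingMap (t : ℝ) :
    C^∞⟮I.prod 𝓘(ℝ, F), TotalSpace F E; I.prod 𝓘(ℝ, F), TotalSpace F E⟯ :=
  ⟨fiberScaling F t, contMDiff_fiberScaling t⟩

theorem fiberScaling_fiberScaling (s t : ℝ) (v : TotalSpace F E) :
    fiberScaling F s (fiberScaling F t v) = fiberScaling F (s * t) v :=
   congrArg (TotalSpace.mk v.proj) (smul_smul s t v.2)

theorem fiberScaling_one (v : TotalSpace F E) : fiberScaling F 1 v = v := by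
  simp [fiberScaling]

theorem mfderiv_fiberScaling_comp {s t : ℝ} (h : s * t = 1) (v : TotalSpace F E) :
    (mfderiv (I.prod 𝓘(ℝ, F)) (I.prod 𝓘(ℝ, F)) (fiberScaling F s : TotalSpace F E → _)
      (fiberScaling F t v)).comp
      (mfderiv (I.prod 𝓘(ℝ, F)) (I.prod 𝓘(ℝ, F)) (fiberScaling F t : TotalSpace F E → _) v) =
      ContinuousLinearMap.id ℝ _ := by
  have hd : ∀ (r : ℝ) (w : TotalSpace F E), MDifferentiableAt (I.prod 𝓘(ℝ, F)) (I.prod 𝓘(ℝ, F))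
      (fiberScaling F r : TotalSpace F E → _) w := fun r w ↦
    (contMDiff_fiberScaling r w).mdifferentiableAt (by simp)
  rw [← mfderiv_comp v (hd _ _) (hd _ _)]
  have h1 : (fiberScaling F s : TotalSpace F E → _) ∘ fiberScaling F t = id := by
    ext1 w
    rw [Function.comp_apply, fiberScaling_fiberScaling, h, fiberScaling_one, id]
  rw [h1, mfderiv_id]

/-- This turns the covector transport in the pullback of multivector fields into composition of
functions with the scaling by `t⁻¹`. -/
theorem differential_comp_inverse_mfderiv_fiberScaling {t : ℝ} (ht : t ≠ 0)
    (f : C^∞⟮I.prod 𝓘(ℝ, F), TotalSpace F E; 𝓘(ℝ), ℝ⟯) (v : TotalSpace F E) :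
    (differential (I.prod 𝓘(ℝ, F)) f v).comp
      (mfderiv (I.prod 𝓘(ℝ, F)) (I.prod 𝓘(ℝ, F)) (fiberScaling F t) v).inverse =
    differential (I.prod 𝓘(ℝ, F)) (f.comp (fiberScalingMap I F E t⁻¹)) (fiberScaling F t v) := by
  have hv : fiberScaling F t⁻¹ (fiberScaling F t v) = v := by
    rw [fiberScaling_fiberScaling, inv_mul_cancel₀ ht, fiberScaling_one]
  -- Each tangent space is the model space by definition; stating the maps there allows rewriting
  -- along `hv`, which changes the base point.
  let A : EM × F →L[ℝ] EM × F :=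
    mfderiv (I.prod 𝓘(ℝ, F)) (I.prod 𝓘(ℝ, F)) (fiberScaling F t : TotalSpace F E → _) v
  let d : TotalSpace F E → EM × F →L[ℝ] EM × F := fun w ↦
    mfderiv (I.prod 𝓘(ℝ, F)) (I.prod 𝓘(ℝ, F)) (fiberScaling F t : TotalSpace F E → _) w
  let B : EM × F →L[ℝ] EM × F :=
    mfderiv (I.prod 𝓘(ℝ, F)) (I.prod 𝓘(ℝ, F)) (fiberScaling F t⁻¹ : TotalSpace F E → _)
      (fiberScaling F t v)
  let df : TotalSpace F E → EM × F →L[ℝ] ℝ := fun w ↦ differential (I.prod 𝓘(ℝ, F)) f w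
  have h1 : B.comp A = ContinuousLinearMap.id ℝ _ :=
    mfderiv_fiberScaling_comp (I := I) (inv_mul_cancel₀ ht) v
  have h2 : (d (fiberScaling F t⁻¹ (fiberScaling F t v))).comp B = ContinuousLinearMap.id ℝ _ :=
    mfderiv_fiberScaling_comp (I := I) (mul_inv_cancel₀ ht) (fiberScaling F t v)
  rw [hv] at h2
  have h3 : A.inverse = B := ContinuousLinearMap.inverse_eq h2 h1
  have h4 := differential_comp f (fiberScalingMap I F E t⁻¹) (fiberScaling F t v)
  change _ = (df (fiberScaling F t⁻¹ (fiberScaling F t v))).comp B at h4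
  rw [hv, ← h3] at h4
  exact h4.symm

theorem contMDiff_fiberScaling_curve (v : TotalSpace F E) [ContMDiffVectorBundle ∞ F E I] :
    ContMDiff 𝓘(ℝ) (I.prod 𝓘(ℝ, F)) ∞ (fun t : ℝ ↦ fiberScaling F t v) := by
  have hx := mem_baseSet_trivializationAt F E v.proj
  have h1 := (contMDiff_mk_symm (I := I) (F := F) (E := E) v.proj).comp
    ((ContinuousLinearMap.id ℝ ℝ).smulRight (trivializationAt F E v.proj v).2).contMDiff
  refine h1.congr fun t ↦ ?_
  change TotalSpace.mk' F v.proj (t • v.2) = TotalSpace.mk' F v.proj _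
  congr 1
  have h2 := ((trivializationAt F E v.proj).symmₗ ℝ v.proj).map_smul t
    (trivializationAt F E v.proj v).2
  rw [Trivialization.coe_symmₗ _ hx] at h2
  rw [(trivializationAt F E v.proj).symm_proj_apply v hx] at h2
  exact h2.symm

end TotalSpaceGeometry

/-! ### Horizontal and vertical components on the total space. -/

section VerticalAndSpanning

open Set Filter Topology

universe u v

variable {EM : Type u} [NormedAddCommGroup EM] [NormedSpace ℝ EM]
  {HM : Type*} [TopologicalSpace HM] {I : ModelWithCorners ℝ EM HM}
  {M : Type*} [TopologicalSpace M] [ChartedSpace HM M]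
  {F : Type v} [NormedAddCommGroup F] [NormedSpace ℝ F]
  {E : M → Type*} [TopologicalSpace (TotalSpace F E)]
  [∀ x, AddCommGroup (E x)] [∀ x, Module ℝ (E x)] [∀ x, TopologicalSpace (E x)]
  [FiberBundle F E] [VectorBundle ℝ F E] [ContMDiffVectorBundle ∞ F E I]

/-- At a critical point of a smooth function, its restriction to the fiber, read in the model fiber,
has a critical point. -/
theorem fderiv_fiber_eq_zero (f : C^∞⟮I.prod 𝓘(ℝ, F), TotalSpace F E; 𝓘(ℝ), ℝ⟯)
    {v : TotalSpace F E} (h : differential (I.prod 𝓘(ℝ, F)) f v = 0) :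
    fderiv ℝ (fun w ↦ f ⟨v.proj, (trivializationAt F E v.proj).symm v.proj w⟩)
      (trivializationAt F E v.proj v).2 = 0 := by
  let k : C^∞⟮𝓘(ℝ, F), F; I.prod 𝓘(ℝ, F), TotalSpace F E⟯ := ⟨_, contMDiff_mk_symm v.proj⟩
  have hk : k (trivializationAt F E v.proj v).2 = v := by
    change TotalSpace.mk' F v.proj _ = TotalSpace.mk' F v.proj v.2
    rw [(trivializationAt F E v.proj).symm_proj_apply v (mem_baseSet_trivializationAt F E v.proj)]
  have h1 := differential_comp f k (trivializationAt F E v.proj v).2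
  let df : TotalSpace F E → EM × F →L[ℝ] ℝ := fun w ↦ differential (I.prod 𝓘(ℝ, F)) f w
  have h2 : df (k (trivializationAt F E v.proj v).2) = 0 := by
    rw [hk]
    exact h
  change _ = (df (k (trivializationAt F E v.proj v).2)).comp _ at h1
  rw [h2] at h1
  have h3 : mfderiv 𝓘(ℝ, F) 𝓘(ℝ) (f ∘ k) (trivializationAt F E v.proj v).2 = 0 := by
    ext w
    exact DFunLike.congr_fun h1 w
  rw [mfderiv_eq_fderiv] at h3
  exact h3

/-- A trivialization is a local diffeomorphism whose two components are the projection and the fiber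
coordinate. -/
theorem eq_zero_of_mfderiv_eq_zero [IsManifold I ∞ M] {v : TotalSpace F E}
    {X : TangentSpace (I.prod 𝓘(ℝ, F)) v}
    (h1 : mfderiv (I.prod 𝓘(ℝ, F)) I TotalSpace.proj v X = 0)
    (h2 : mfderiv (I.prod 𝓘(ℝ, F)) 𝓘(ℝ, F)
      (fun w ↦ (trivializationAt F E v.proj w).2) v X = 0) : X = 0 := by
  set e := trivializationAt F E v.proj with he
  have hv : v ∈ e.source := e.mem_source.2 (mem_baseSet_trivializationAt F E v.proj)
  have hev : e v ∈ e.target := e.map_source hv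
  have hesymm : MDifferentiableAt (I.prod 𝓘(ℝ, F)) (I.prod 𝓘(ℝ, F))
      e.toOpenPartialHomeomorph.symm (e v) :=
    ((e.contMDiffOn_symm (IB := I) (n := ∞)).contMDiffAt
      (e.open_target.mem_nhds hev)).mdifferentiableAt (by simp)
  have hd1 : MDifferentiableAt (I.prod 𝓘(ℝ, F)) I (TotalSpace.proj : TotalSpace F E → M) v :=
    (contMDiff_proj E (n := ∞) v).mdifferentiableAt (by simp)
  have hd2 : MDifferentiableAt (I.prod 𝓘(ℝ, F)) 𝓘(ℝ, F) (fun w ↦ (e w).2) v :=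
    ((contMDiffAt_snd.comp v ((e.contMDiffOn (IB := I) (n := ∞)).contMDiffAt
      (e.open_source.mem_nhds hv)))).mdifferentiableAt (by simp)
  have hpq : (e : TotalSpace F E → M × F) =ᶠ[𝓝 v] fun w ↦ (w.proj, (e w).2) := by
    filter_upwards [e.open_source.mem_nhds hv] with w hw
    exact Prod.ext (e.coe_fst hw) rfl
  have hde : MDifferentiableAt (I.prod 𝓘(ℝ, F)) (I.prod 𝓘(ℝ, F)) e v :=
    (hd1.prodMk hd2).congr_of_eventuallyEq hpq
  have hid : e.toOpenPartialHomeomorph.symm ∘ e =ᶠ[𝓝 v] id := by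
    filter_upwards [e.open_source.mem_nhds hv] with w hw
    exact e.left_inv hw
  have h3 := hid.mfderiv_eq (I := I.prod 𝓘(ℝ, F)) (I' := I.prod 𝓘(ℝ, F))
  rw [mfderiv_comp v hesymm hde, mfderiv_id, hpq.mfderiv_eq, mfderiv_prodMk hd1 hd2] at h3
  have h4 := DFunLike.congr_fun h3 X
  refine h4.symm.trans ?_
  have h5 : ((mfderiv (I.prod 𝓘(ℝ, F)) I TotalSpace.proj v X,
      mfderiv (I.prod 𝓘(ℝ, F)) 𝓘(ℝ, F) (fun w ↦ (e w).2) v X) : EM × F) = 0 := Prod.ext h1 h2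
  let T : EM × F →L[ℝ] EM × F :=
    mfderiv (I.prod 𝓘(ℝ, F)) (I.prod 𝓘(ℝ, F)) e.toOpenPartialHomeomorph.symm (e v)
  exact (congrArg T h5).trans (map_zero T)

end VerticalAndSpanning

/-! ### Affine functions on the dual bundle and their differentials. -/

section LinearFunctions

open Set Filter Topology

universe u v

variable {EM : Type u} [NormedAddCommGroup EM] [NormedSpace ℝ EM]
  {HM : Type*} [TopologicalSpace HM] {I : ModelWithCorners ℝ EM HM}
  {M : Type*} [TopologicalSpace M] [ChartedSpace HM M]
  {F : Type v} [NormedAddCommGroup F] [NormedSpace ℝ F]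
  {E : M → Type*} [TopologicalSpace (TotalSpace F E)]
  [∀ x, AddCommGroup (E x)] [∀ x, Module ℝ (E x)] [∀ x, TopologicalSpace (E x)]
  [FiberBundle F E] [VectorBundle ℝ F E] [ContMDiffVectorBundle ∞ F E I]

@[simp]
theorem linearFunction_apply (σ : Cₛ^∞⟮I; F, E⟯) (ξ : TotalSpace (F →L[ℝ] ℝ) (DualBundle E)) :
    linearFunction σ ξ = ξ.2 (σ ξ.proj) := rfl

theorem linearFunction_add (σ τ : Cₛ^∞⟮I; F, E⟯) :
    linearFunction (σ + τ) = linearFunction σ + linearFunction τ := by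
  ext ξ
  exact map_add ξ.2 _ _

theorem linearFunction_smul (c : ℝ) (σ : Cₛ^∞⟮I; F, E⟯) :
    linearFunction (c • σ) = c • linearFunction σ := by
  ext ξ
  exact map_smul ξ.2 _ _

theorem linearFunction_funSMul (f : C^∞⟮I, M; 𝓘(ℝ), ℝ⟯) (σ : Cₛ^∞⟮I; F, E⟯) :
    linearFunction (ContMDiffSection.funSMul f σ) =
      basePullback (F →L[ℝ] ℝ) (DualBundle E) f * linearFunction σ := by
  ext ξ
  exact map_smul ξ.2 _ _

theorem linearFunction_sum {ι : Type*} (s : Finset ι) (σ : ι → Cₛ^∞⟮I; F, E⟯) :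
    linearFunction (∑ i ∈ s, σ i) = ∑ i ∈ s, linearFunction (σ i) := by
  ext ξ
  rw [ContMDiffMap.sum_apply, linearFunction_apply, ContMDiffSection.sum_apply, map_sum]
  rfl

variable (I F E) in
/-- The function `φ_σ + u ∘ p` on the total space of `E*`, for a section `σ` of `E` and a smooth
function `u` on the base. -/
def affineFunction : Cₛ^∞⟮I; F, E⟯ × C^∞⟮I, M; 𝓘(ℝ), ℝ⟯ →ₗ[ℝ]
    C^∞⟮I.prod 𝓘(ℝ, F →L[ℝ] ℝ), TotalSpace (F →L[ℝ] ℝ) (DualBundle E); 𝓘(ℝ), ℝ⟯ where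
  toFun l := linearFunction l.1 + basePullback (F →L[ℝ] ℝ) (DualBundle E) l.2
  map_add' l l' := by
    rw [Prod.fst_add, Prod.snd_add, linearFunction_add, basePullback_add]
    abel
  map_smul' c l := by
    rw [Prod.smul_fst, Prod.smul_snd, linearFunction_smul, basePullback_smul, RingHom.id_apply,
      smul_add]

@[simp]
theorem affineFunction_apply (l : Cₛ^∞⟮I; F, E⟯ × C^∞⟮I, M; 𝓘(ℝ), ℝ⟯)
    (ξ : TotalSpace (F →L[ℝ] ℝ) (DualBundle E)) :
    affineFunction I F E l ξ = ξ.2 (l.1 ξ.proj) + l.2 ξ.proj := rfl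

theorem affineFunction_inl (σ : Cₛ^∞⟮I; F, E⟯) :
    affineFunction I F E (σ, 0) = linearFunction σ := by
  ext ξ
  exact add_zero _

theorem affineFunction_inr (f : C^∞⟮I, M; 𝓘(ℝ), ℝ⟯) :
    affineFunction I F E (0, f) = basePullback (F →L[ℝ] ℝ) (DualBundle E) f := by
  ext ξ
  exact (congrArg (· + f ξ.proj) (map_zero ξ.2)).trans (zero_add _)

theorem trivializationAt_dual_apply {x : M} {ξ : TotalSpace (F →L[ℝ] ℝ) (DualBundle E)}
    (hξ : ξ.proj ∈ (trivializationAt F E x).baseSet) (w : F) :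
    (trivializationAt (F →L[ℝ] ℝ) (DualBundle E) x ξ).2 w =
      ξ.2 ((trivializationAt F E x).symm ξ.proj w) := by
  rw [hom_trivializationAt_apply]
  change (Bundle.Trivial.trivialization M ℝ).continuousLinearMapAt ℝ ξ.proj
    (ξ.2 ((trivializationAt F E x).symmL ℝ ξ.proj w)) = _
  rw [Trivialization.symmL_apply _ hξ, Bundle.Trivial.continuousLinearMapAt_trivialization]
  rfl

variable [FiniteDimensional ℝ EM] [T2Space M] [IsManifold I ∞ M] [I.Boundaryless]
  [FiniteDimensional ℝ F]

/-- By duality it suffices that no nonzero tangent vector is annihilated by every affine function.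
Pullbacks detect the component along the base; linear functions of sections constant in a
trivialization detect the fiber component. -/
theorem exists_differential_affineFunction_eq (ξ : TotalSpace (F →L[ℝ] ℝ) (DualBundle E))
    (α : CotangentSpace (I.prod 𝓘(ℝ, F →L[ℝ] ℝ)) ξ) :
    ∃ l, differential (I.prod 𝓘(ℝ, F →L[ℝ] ℝ)) (affineFunction I F E l) ξ = α := by
  refine exists_differential_eq_of_separating _ (fun X hX ↦ ?_) α
  refine eq_zero_of_mfderiv_eq_zero (E := DualBundle E) ?_ ?_
  · refine eq_zero_of_differential_apply_eq_zero fun f ↦ ?_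
    have h1 := hX (0, f)
    rw [affineFunction_inr, differential_basePullback] at h1
    exact h1
  · have hξ := mem_baseSet_trivializationAt F E ξ.proj
    let e := trivializationAt (F →L[ℝ] ℝ) (DualBundle E) ξ.proj
    have hsrc : ξ ∈ e.source := e.mem_source.2 (mem_baseSet_trivializationAt _ _ ξ.proj)
    have hd : MDifferentiableAt (I.prod 𝓘(ℝ, F →L[ℝ] ℝ)) 𝓘(ℝ, F →L[ℝ] ℝ)
        (fun w ↦ (e w).2) ξ :=
      ((contMDiffAt_snd.comp ξ ((e.contMDiffOn (IB := I) (n := ∞)).contMDiffAt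
        (e.open_source.mem_nhds hsrc)))).mdifferentiableAt (by simp)
    refine ContinuousLinearMap.ext fun w ↦ ?_
    obtain ⟨σ, hσ⟩ := exists_section_eventuallyEq_symm (I := I) (E := E) ξ.proj w
    let ev : (F →L[ℝ] ℝ) →L[ℝ] ℝ := ContinuousLinearMap.apply ℝ ℝ w
    have h1 : (linearFunction σ : TotalSpace (F →L[ℝ] ℝ) (DualBundle E) → ℝ) =ᶠ[𝓝 ξ]
        ev ∘ fun η ↦ (e η).2 := by
      have hp := (FiberBundle.continuous_proj (F →L[ℝ] ℝ) (DualBundle E)).continuousAt (x := ξ)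
      filter_upwards [hp.eventually hσ, hp.eventually
        ((trivializationAt F E ξ.proj).open_baseSet.mem_nhds hξ)] with η h1 h2
      rw [linearFunction_apply, h1]
      exact (trivializationAt_dual_apply h2 w).symm
    have h2 := h1.mfderiv_eq (I := I.prod 𝓘(ℝ, F →L[ℝ] ℝ)) (I' := 𝓘(ℝ))
    rw [mfderiv_comp ξ ev.mdifferentiableAt hd, ContinuousLinearMap.mfderiv_eq] at h2
    have h3 := hX (σ, 0)
    rw [affineFunction_inl] at h3
    exact (DFunLike.congr_fun h2 X).symm.trans h3

/-- A section through `v` splits the projection, so pulling back along it recovers the differential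
on the base. -/
theorem eq_zero_of_differential_basePullback_eq_zero {G : Type*} [NormedAddCommGroup G]
    [NormedSpace ℝ G] {V : M → Type*} [TopologicalSpace (TotalSpace G V)]
    [∀ x, AddCommGroup (V x)] [∀ x, Module ℝ (V x)] [∀ x, TopologicalSpace (V x)]
    [FiberBundle G V] [VectorBundle ℝ G V] [ContMDiffVectorBundle ∞ G V I]
    {f : C^∞⟮I, M; 𝓘(ℝ), ℝ⟯} {v : TotalSpace G V}
    (h : differential (I.prod 𝓘(ℝ, G)) (basePullback G V f) v = 0) :
    differential I f v.proj = 0 := by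
  obtain ⟨s, hs⟩ := exists_section_apply_eq I G v.proj v.2
  let k : C^∞⟮I, M; I.prod 𝓘(ℝ, G), TotalSpace G V⟯ := ⟨_, s.contMDiff⟩
  have hk : k v.proj = v := by
    change TotalSpace.mk' G v.proj (s v.proj) = v
    rw [hs]
  have h1 := differential_comp (basePullback G V f) k v.proj
  let df : TotalSpace G V → EM × G →L[ℝ] ℝ := fun w ↦
    differential (I.prod 𝓘(ℝ, G)) (basePullback G V f) w
  have h2 : df (k v.proj) = 0 := by
    rw [hk]
    exact h
  change _ = (df (k v.proj)).comp _ at h1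
  rw [h2] at h1
  have h3 : (basePullback G V f).comp k = f := rfl
  rw [h3] at h1
  exact h1.trans (ContinuousLinearMap.zero_comp _)

/-- On the fiber of `ξ` the function is evaluation at the vector `l.1 ξ.proj` plus a constant, so a
vanishing vertical derivative forces that vector to be zero. -/
theorem apply_eq_zero_of_differential_affineFunction_eq_zero
    {ξ : TotalSpace (F →L[ℝ] ℝ) (DualBundle E)} {l : Cₛ^∞⟮I; F, E⟯ × C^∞⟮I, M; 𝓘(ℝ), ℝ⟯}
    (h : differential (I.prod 𝓘(ℝ, F →L[ℝ] ℝ)) (affineFunction I F E l) ξ = 0) :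
    l.1 ξ.proj = 0 := by
  have hξ := mem_baseSet_trivializationAt F E ξ.proj
  have hξ' := mem_baseSet_trivializationAt (F →L[ℝ] ℝ) (DualBundle E) ξ.proj
  have h1 := fderiv_fiber_eq_zero _ h
  set e := trivializationAt (F →L[ℝ] ℝ) (DualBundle E) ξ.proj with he
  let ev : (F →L[ℝ] ℝ) →L[ℝ] ℝ :=
    ContinuousLinearMap.apply ℝ ℝ (trivializationAt F E ξ.proj ⟨ξ.proj, l.1 ξ.proj⟩).2
  have h2 : (fun w : F →L[ℝ] ℝ ↦ affineFunction I F E l ⟨ξ.proj, e.symm ξ.proj w⟩) =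
      fun w ↦ ev w + l.2 ξ.proj := by
    ext w
    rw [affineFunction_apply]
    congr 1
    have h3 := trivializationAt_dual_apply (ξ := ⟨ξ.proj, e.symm ξ.proj w⟩) hξ
      (trivializationAt F E ξ.proj ⟨ξ.proj, l.1 ξ.proj⟩).2
    rw [(trivializationAt F E ξ.proj).symm_apply_apply_mk hξ, ← he, e.apply_mk_symm hξ'] at h3
    exact h3.symm
  rw [h2, fderiv_add_const, ev.fderiv] at h1
  have h4 : (trivializationAt F E ξ.proj ⟨ξ.proj, l.1 ξ.proj⟩).2 = 0 :=
    SeparatingDual.eq_zero_of_forall_dual_eq_zero (R := ℝ) fun w ↦ DFunLike.congr_fun h1 w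
  let eE := (trivializationAt F E ξ.proj).continuousLinearEquivAt ℝ ξ.proj hξ
  exact eE.injective (h4.trans (map_zero eE).symm)

end LinearFunctions

/-! ### The semidirect product of sections and functions. -/

namespace LieAlgebroidStructure

open Set Filter Topology

universe u v

variable {EM : Type u} [NormedAddCommGroup EM] [NormedSpace ℝ EM]
  {HM : Type*} [TopologicalSpace HM] {I : ModelWithCorners ℝ EM HM}
  {M : Type*} [TopologicalSpace M] [ChartedSpace HM M] [IsManifold I ∞ M] [I.Boundaryless]
  {F : Type v} [NormedAddCommGroup F] [NormedSpace ℝ F]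
  {E : M → Type*} [TopologicalSpace (TotalSpace F E)]
  [∀ x, AddCommGroup (E x)] [∀ x, Module ℝ (E x)] [∀ x, TopologicalSpace (E x)]
  [FiberBundle F E] [VectorBundle ℝ F E]
  (A : LieAlgebroidStructure I F E)

theorem bracket_skew (σ τ : Cₛ^∞⟮I; F, E⟯) : A.bracket σ τ = -A.bracket τ σ := by
  have h := A.bracket_self (σ + τ)
  simp only [map_add, LinearMap.add_apply, A.bracket_self, zero_add, add_zero] at h
  exact eq_neg_of_add_eq_zero_right h

/-- The action `a(σ) f` of sections on functions through the anchor. -/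
def anchorAction :
    Cₛ^∞⟮I; F, E⟯ →ₗ[ℝ] C^∞⟮I, M; 𝓘(ℝ), ℝ⟯ →ₗ[ℝ] C^∞⟮I, M; 𝓘(ℝ), ℝ⟯ :=
  LinearMap.mk₂ ℝ (fun σ f ↦ ⟨fun x ↦ differential I f x (A.anchor x (σ x)),
      contMDiff_differential_apply f (ContMDiff.clm_bundle_apply (F₁ := F) (F₂ := EM)
        A.anchor.contMDiff σ.contMDiff)⟩)
    (fun σ τ f ↦ ContMDiffMap.ext fun x ↦
      (congrArg (differential I f x) (map_add (A.anchor x) (σ x) (τ x))).trans (map_add _ _ _))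
    (fun c σ f ↦ ContMDiffMap.ext fun x ↦
      (congrArg (differential I f x) (map_smul (A.anchor x) c (σ x))).trans (map_smul _ _ _))
    (fun σ f g ↦ ContMDiffMap.ext fun x ↦
      DFunLike.congr_fun (differential_add f g x) (A.anchor x (σ x)))
    (fun c σ f ↦ ContMDiffMap.ext fun x ↦
      DFunLike.congr_fun (differential_smul c f x) (A.anchor x (σ x)))

theorem anchorAction_apply (σ : Cₛ^∞⟮I; F, E⟯) (f : C^∞⟮I, M; 𝓘(ℝ), ℝ⟯) (x : M) :
    A.anchorAction σ f x = differential I f x (A.anchor x (σ x)) := rfl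

theorem anchorAction_apply_eq_zero {σ : Cₛ^∞⟮I; F, E⟯} {x : M} (h : σ x = 0)
    (f : C^∞⟮I, M; 𝓘(ℝ), ℝ⟯) : A.anchorAction σ f x = 0 := by
  rw [anchorAction_apply, h, map_zero, map_zero]

theorem bracket_funSMul (σ τ : Cₛ^∞⟮I; F, E⟯) (f : C^∞⟮I, M; 𝓘(ℝ), ℝ⟯) :
    A.bracket σ (ContMDiffSection.funSMul f τ) =
      ContMDiffSection.funSMul f (A.bracket σ τ) +
        ContMDiffSection.funSMul (A.anchorAction σ f) τ := by
  ext x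
  exact A.leibniz σ τ f x

/-- The anchor is a homomorphism of Lie algebras. -/
theorem anchorAction_bracket (σ τ : Cₛ^∞⟮I; F, E⟯) (f : C^∞⟮I, M; 𝓘(ℝ), ℝ⟯) :
    A.anchorAction (A.bracket σ τ) f =
      A.anchorAction σ (A.anchorAction τ f) - A.anchorAction τ (A.anchorAction σ f) := by
  ext x
  change _ = A.anchorAction σ (A.anchorAction τ f) x - A.anchorAction τ (A.anchorAction σ f) x
  -- With `ρ x ≠ 0`, comparing the Jacobi identities for `f ρ` and for `ρ` isolates the claim as a
  -- coefficient of `ρ x`. If every section vanishes at `x`, all three terms are zero.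
  by_cases h : ∃ ρ : Cₛ^∞⟮I; F, E⟯, ρ x ≠ 0
  · obtain ⟨ρ, hρ⟩ := h
    have h1 := congrArg (fun s ↦ s x) (A.jacobi σ τ (ContMDiffSection.funSMul f ρ))
    have h2 := congrArg (fun s ↦ s x) (A.jacobi σ τ ρ)
    simp only [bracket_funSMul, map_add, ContMDiffSection.coe_add, Pi.add_apply,
      ContMDiffSection.funSMul_apply] at h1 h2
    rw [h2] at h1
    have h3 : (A.anchorAction (A.bracket σ τ) f x - (A.anchorAction σ (A.anchorAction τ f) x -
        A.anchorAction τ (A.anchorAction σ f) x)) • ρ x = 0 := by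
      linear_combination (norm := module) (-1 : ℝ) • h1
    exact sub_eq_zero.1 ((smul_eq_zero.1 h3).resolve_right hρ)
  · push Not at h
    rw [A.anchorAction_apply_eq_zero (h _), A.anchorAction_apply_eq_zero (h _),
      A.anchorAction_apply_eq_zero (h _), sub_zero]

/-- The Lie bracket on the semidirect product of the sections with the smooth functions. -/
def affineBracket :
    (Cₛ^∞⟮I; F, E⟯ × C^∞⟮I, M; 𝓘(ℝ), ℝ⟯) →ₗ[ℝ] (Cₛ^∞⟮I; F, E⟯ × C^∞⟮I, M; 𝓘(ℝ), ℝ⟯) →ₗ[ℝ]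
      (Cₛ^∞⟮I; F, E⟯ × C^∞⟮I, M; 𝓘(ℝ), ℝ⟯) :=
  LinearMap.mk₂ ℝ
    (fun l l' ↦ (A.bracket l.1 l'.1, A.anchorAction l.1 l'.2 - A.anchorAction l'.1 l.2))
    (fun l m l' ↦ Prod.ext (by simp) (by simp; abel))
    (fun c l l' ↦ Prod.ext (by simp) (by simp [smul_sub]))
    (fun l l' m ↦ Prod.ext (by simp) (by simp; abel))
    (fun c l l' ↦ Prod.ext (by simp) (by simp [smul_sub]))

theorem affineBracket_apply (l l' : Cₛ^∞⟮I; F, E⟯ × C^∞⟮I, M; 𝓘(ℝ), ℝ⟯) :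
    A.affineBracket l l' =
      (A.bracket l.1 l'.1, A.anchorAction l.1 l'.2 - A.anchorAction l'.1 l.2) := rfl

theorem affineBracket_self (l : Cₛ^∞⟮I; F, E⟯ × C^∞⟮I, M; 𝓘(ℝ), ℝ⟯) :
    A.affineBracket l l = 0 := by
  rw [affineBracket_apply, A.bracket_self, sub_self]
  rfl

theorem affineBracket_jacobi (l l' l'' : Cₛ^∞⟮I; F, E⟯ × C^∞⟮I, M; 𝓘(ℝ), ℝ⟯) :
    A.affineBracket l (A.affineBracket l' l'') =
      A.affineBracket (A.affineBracket l l') l'' + A.affineBracket l' (A.affineBracket l l'') := by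
  simp only [affineBracket_apply]
  refine Prod.ext (A.jacobi _ _ _) ?_
  simp only [Prod.snd_add, anchorAction_bracket, map_sub]
  abel

variable [ContMDiffVectorBundle ∞ F E I]

/-- If `A` induces the Poisson structure `P`, then `P` is determined on functions of degree at
most one by the bracket and the anchor, up to the two identities assumed here. -/
theorem Induces.bracket_affineFunction {A : LieAlgebroidStructure I F E}
    {P : PoissonStructure (I.prod 𝓘(ℝ, F →L[ℝ] ℝ)) (TotalSpace (F →L[ℝ] ℝ) (DualBundle E))}
    (h : A.Induces P)
    (h1 : ∀ σ f, P.bracket (linearFunction σ) (basePullback (F →L[ℝ] ℝ) (DualBundle E) f) =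
      basePullback _ _ (A.anchorAction σ f))
    (h0 : ∀ f g, P.bracket (basePullback (F →L[ℝ] ℝ) (DualBundle E) f) (basePullback _ _ g) = 0)
    (l l' : Cₛ^∞⟮I; F, E⟯ × C^∞⟮I, M; 𝓘(ℝ), ℝ⟯) :
    P.bracket (affineFunction I F E l) (affineFunction I F E l') =
      affineFunction I F E (A.affineBracket l l') := by
  change P.bracket (linearFunction l.1 + basePullback _ _ l.2)
    (linearFunction l'.1 + basePullback _ _ l'.2) = linearFunction (A.bracket l.1 l'.1) +
      (basePullback _ _ (A.anchorAction l.1 l'.2) - basePullback _ _ (A.anchorAction l'.1 l.2))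
  rw [map_add, map_add, LinearMap.add_apply, LinearMap.add_apply, h, h1, h0, P.skew _
    (linearFunction l'.1), h1]
  abel

/-- The bracket of `σ` with `f τ` is expanded by the Leibniz rule of `P` and by that of `A`; the
terms containing the bracket of `σ` and `τ` cancel. -/
theorem Induces.bracket_basePullback_mul {A : LieAlgebroidStructure I F E}
    {P : PoissonStructure (I.prod 𝓘(ℝ, F →L[ℝ] ℝ)) (TotalSpace (F →L[ℝ] ℝ) (DualBundle E))}
    (h : A.Induces P) (σ τ : Cₛ^∞⟮I; F, E⟯) (f : C^∞⟮I, M; 𝓘(ℝ), ℝ⟯) :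
    P.bracket (linearFunction σ) (basePullback (F →L[ℝ] ℝ) (DualBundle E) f) * linearFunction τ =
      basePullback _ _ (A.anchorAction σ f) * linearFunction τ := by
  have h1 := h σ (ContMDiffSection.funSMul f τ)
  rw [linearFunction_funSMul, P.leibniz, h, bracket_funSMul, linearFunction_add,
    linearFunction_funSMul, linearFunction_funSMul, add_comm] at h1
  exact add_left_cancel h1

variable [FiniteDimensional ℝ EM] [T2Space M] [FiniteDimensional ℝ F]

/-- The well-definedness behind the Poisson structure. Since `σ` vanishes at the base point, it is
to first order a combination `∑ fᵢ sᵢ` with `fᵢ` zero there. Both the differential of its linear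
function at `ξ` and the pairing of `ξ` with its bracket are then expressed by one function `w` on
the base, and the hypothesis says that `w + u` is critical. -/
theorem affineBracket_apply_eq_zero {ξ : TotalSpace (F →L[ℝ] ℝ) (DualBundle E)}
    {l : Cₛ^∞⟮I; F, E⟯ × C^∞⟮I, M; 𝓘(ℝ), ℝ⟯}
    (h : differential (I.prod 𝓘(ℝ, F →L[ℝ] ℝ)) (affineFunction I F E l) ξ = 0)
    (l' : Cₛ^∞⟮I; F, E⟯ × C^∞⟮I, M; 𝓘(ℝ), ℝ⟯) :
    affineFunction I F E (A.affineBracket l l') ξ = 0 := by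
  obtain ⟨σ, u⟩ := l
  obtain ⟨τ, v⟩ := l'
  have hσ : σ ξ.proj = 0 := apply_eq_zero_of_differential_affineFunction_eq_zero h
  obtain ⟨s, hs⟩ := exists_section_frame I F E ξ.proj
  obtain ⟨g, f, hg, hdg, hf, hexp⟩ := hs σ
  have hf := hf hσ
  -- Freezing each linear function of `sᵢ` at its value at `ξ` loses nothing to first order, because
  -- `fᵢ` vanishes at the base point.
  let w : C^∞⟮I, M; 𝓘(ℝ), ℝ⟯ := ∑ i, ξ.2 (s i ξ.proj) • f i
  have hφσ : differential (I.prod 𝓘(ℝ, F →L[ℝ] ℝ)) (linearFunction σ) ξ =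
      differential (I.prod 𝓘(ℝ, F →L[ℝ] ℝ)) (basePullback (F →L[ℝ] ℝ) (DualBundle E) w) ξ := by
    have e1 : linearFunction σ = basePullback (F →L[ℝ] ℝ) (DualBundle E) g * linearFunction σ +
        ∑ i, basePullback (F →L[ℝ] ℝ) (DualBundle E) (f i) * linearFunction (s i) := by
      conv_lhs => rw [hexp]
      rw [linearFunction_add, linearFunction_sum]
      simp only [linearFunction_funSMul]
    have e2 : basePullback (F →L[ℝ] ℝ) (DualBundle E) w =
        ∑ i, ξ.2 (s i ξ.proj) • basePullback (F →L[ℝ] ℝ) (DualBundle E) (f i) := by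
      ext η
      rw [ContMDiffMap.sum_apply, basePullback_apply, ContMDiffMap.sum_apply]
      rfl
    rw [e1, e2, differential_add, differential_mul, differential_sum, differential_sum,
      differential_basePullback g, hdg, basePullback_apply, hg, zero_smul,
      ContinuousLinearMap.zero_comp, smul_zero, add_zero, zero_add]
    refine Finset.sum_congr rfl fun i _ ↦ ?_
    rw [differential_mul, basePullback_apply, hf i, zero_smul, zero_add, differential_smul]
    rfl
  have hwu : differential I (w + u) ξ.proj = 0 := by
    refine eq_zero_of_differential_basePullback_eq_zero (G := F →L[ℝ] ℝ) (V := DualBundle E) ?_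
    rw [basePullback_add, differential_add, ← hφσ, ← differential_add]
    exact h
  have hbr : A.bracket τ σ ξ.proj = ∑ i, differential I (f i) ξ.proj (A.anchor ξ.proj (τ ξ.proj)) •
      s i ξ.proj := by
    conv_lhs => rw [hexp]
    rw [map_add, map_sum, ContMDiffSection.coe_add, Pi.add_apply, A.leibniz, hg, hdg,
      ContMDiffSection.sum_apply]
    rw [zero_smul, zero_add]
    rw [show (0 : CotangentSpace I ξ.proj) (A.anchor ξ.proj (τ ξ.proj)) = 0 from rfl, zero_smul,
      zero_add]
    refine Finset.sum_congr rfl fun i _ ↦ ?_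
    rw [A.leibniz, hf i, zero_smul, zero_add]
  have hw : ξ.2 (A.bracket τ σ ξ.proj) = A.anchorAction τ w ξ.proj := by
    rw [hbr, anchorAction_apply, differential_sum, map_sum]
    rw [show (∑ i, differential I (ξ.2 (s i ξ.proj) • f i) ξ.proj)
      (A.anchor ξ.proj (τ ξ.proj)) = ∑ i, (differential I (ξ.2 (s i ξ.proj) • f i) ξ.proj)
      (A.anchor ξ.proj (τ ξ.proj)) from sum_apply _ _ _]
    refine Finset.sum_congr rfl fun i _ ↦ ?_
    rw [differential_smul, map_smul]
    exact mul_comm _ _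
  have hfin : A.anchorAction τ (w + u) ξ.proj = 0 := by
    rw [anchorAction_apply, hwu]
    rfl
  rw [map_add] at hfin
  change A.anchorAction τ w ξ.proj + A.anchorAction τ u ξ.proj = 0 at hfin
  rw [affineFunction_apply, affineBracket_apply, A.bracket_skew]
  change ξ.2 (-A.bracket τ σ ξ.proj) + (A.anchorAction σ v ξ.proj - A.anchorAction τ u ξ.proj) = 0
  rw [map_neg, hw, A.anchorAction_apply_eq_zero hσ]
  linarith

end LieAlgebroidStructure

/-! ### Linearity of a Poisson structure in terms of brackets of functions. -/

section Homogeneity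

open Set Filter Topology

variable {EM : Type*} [NormedAddCommGroup EM] [NormedSpace ℝ EM]
  {HM : Type*} [TopologicalSpace HM] {I : ModelWithCorners ℝ EM HM}
  {M : Type*} [TopologicalSpace M] [ChartedSpace HM M]
  {F : Type*} [NormedAddCommGroup F] [NormedSpace ℝ F]
  {E : M → Type*} [TopologicalSpace (TotalSpace F E)]
  [∀ x, AddCommGroup (E x)] [∀ x, Module ℝ (E x)] [∀ x, TopologicalSpace (E x)]
  [FiberBundle F E] [VectorBundle ℝ F E]

theorem PoissonStructure.HasBivector.pullback_apply
    {P : PoissonStructure (I.prod 𝓘(ℝ, F)) (TotalSpace F E)}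
    {u : MultivectorField (I.prod 𝓘(ℝ, F)) (TotalSpace F E) 2}
    (hu : PoissonStructure.HasBivector (I.prod 𝓘(ℝ, F)) P u) {t : ℝ} (ht : t ≠ 0)
    (f g : C^∞⟮I.prod 𝓘(ℝ, F), TotalSpace F E; 𝓘(ℝ), ℝ⟯) (v : TotalSpace F E) :
    MultivectorField.pullback (I.prod 𝓘(ℝ, F)) (fiberScaling F t) u v
        ![differential (I.prod 𝓘(ℝ, F)) f v, differential (I.prod 𝓘(ℝ, F)) g v] =
      P.bracket (f.comp (fiberScalingMap I F E t⁻¹)) (g.comp (fiberScalingMap I F E t⁻¹))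
        (fiberScaling F t v) := by
  rw [← hu, ← differential_comp_inverse_mfderiv_fiberScaling ht,
    ← differential_comp_inverse_mfderiv_fiberScaling ht]
  refine congrArg (u (fiberScaling F t v)) (funext fun i ↦ ?_)
  fin_cases i <;> rfl

namespace PoissonStructure.IsFiberwiseLinear

variable {P : PoissonStructure (I.prod 𝓘(ℝ, F)) (TotalSpace F E)}

theorem bracket_comp (hP : P.IsFiberwiseLinear I) {t : ℝ} (ht : t ≠ 0)
    (f g : C^∞⟮I.prod 𝓘(ℝ, F), TotalSpace F E; 𝓘(ℝ), ℝ⟯) (v : TotalSpace F E) :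
    P.bracket (f.comp (fiberScalingMap I F E t⁻¹)) (g.comp (fiberScalingMap I F E t⁻¹))
        (fiberScaling F t v) = t⁻¹ * P.bracket f g v := by
  obtain ⟨u, hu, hlin⟩ := hP
  rw [← hu.pullback_apply ht, hlin t ht, ← hu]
  have h : t ^ (1 - ((2 : ℕ) : ℤ)) = t⁻¹ := by
    rw [show (1 - ((2 : ℕ) : ℤ)) = -1 by norm_num, zpow_neg_one]
  change t ^ (1 - ((2 : ℕ) : ℤ)) * _ = _
  rw [h]
  rfl

variable [ContMDiffVectorBundle ∞ F E I]

/-- The bracket has degree -1 under scaling: `h v = t * h (t v)` for `t ≠ 0`. Letting `t → 0` gives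
zero, as `h` is continuous at the zero section. -/
theorem bracket_basePullback_basePullback (hP : P.IsFiberwiseLinear I)
    (f g : C^∞⟮I, M; 𝓘(ℝ), ℝ⟯) :
    P.bracket (basePullback F E f) (basePullback F E g) = 0 := by
  ext v
  set h := P.bracket (basePullback F E f) (basePullback F E g) with hh
  have h1 : ∀ t : ℝ, t ≠ 0 → t * h (fiberScaling F t v) = h v := fun t ht ↦ by
    have h2 := hP.bracket_comp ht (basePullback F E f) (basePullback F E g) v
    change h (fiberScaling F t v) = t⁻¹ * h v at h2
    rw [h2, mul_inv_cancel_left₀ ht]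
  have hc : Continuous fun t : ℝ ↦ t * h (fiberScaling F t v) :=
    continuous_id.mul (h.contMDiff.continuous.comp
      (contMDiff_fiberScaling_curve (I := I) v).continuous)
  have h3 : Tendsto (fun t : ℝ ↦ t * h (fiberScaling F t v)) (𝓝[≠] 0) (𝓝 0) := by
    have := hc.tendsto 0
    rw [zero_mul] at this
    exact this.mono_left nhdsWithin_le_nhds
  have h4 : Tendsto (fun t : ℝ ↦ t * h (fiberScaling F t v)) (𝓝[≠] 0) (𝓝 (h v)) :=
    tendsto_const_nhds.congr' (eventually_mem_nhdsWithin.mono fun t ht ↦ (h1 t ht).symm)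
  exact tendsto_nhds_unique h4 h3

end PoissonStructure.IsFiberwiseLinear

end Homogeneity

/-! ### Existence and uniqueness of the Poisson structure on the dual bundle. -/

namespace LieAlgebroidStructure

open Set Filter Topology

universe u v

variable {EM : Type u} [NormedAddCommGroup EM] [NormedSpace ℝ EM]
  {HM : Type*} [TopologicalSpace HM] {I : ModelWithCorners ℝ EM HM}
  {M : Type*} [TopologicalSpace M] [ChartedSpace HM M] [IsManifold I ∞ M] [I.Boundaryless]
  {F : Type v} [NormedAddCommGroup F] [NormedSpace ℝ F]
  {E : M → Type*} [TopologicalSpace (TotalSpace F E)]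
  [∀ x, AddCommGroup (E x)] [∀ x, Module ℝ (E x)] [∀ x, TopologicalSpace (E x)]
  [FiberBundle F E] [VectorBundle ℝ F E] [ContMDiffVectorBundle ∞ F E I]
  [FiniteDimensional ℝ EM] [T2Space M] [FiniteDimensional ℝ F]

theorem affineFunction_comp_fiberScalingMap (t : ℝ)
    (l : Cₛ^∞⟮I; F, E⟯ × C^∞⟮I, M; 𝓘(ℝ), ℝ⟯) :
    (affineFunction I F E l).comp (fiberScalingMap I (F →L[ℝ] ℝ) (DualBundle E) t) =
      affineFunction I F E (t • l.1, l.2) := by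
  ext ξ
  exact congrArg (· + l.2 ξ.proj) (map_smul ξ.2 t (l.1 ξ.proj)).symm

/-- The section part of the bracket acquires `t⁻²` from its arguments and `t` from evaluation at the
scaled covector; the function part acquires a single `t⁻¹`. -/
theorem affineFunction_affineBracket_fiberScaling (A : LieAlgebroidStructure I F E) {t : ℝ}
    (ht : t ≠ 0) (l l' : Cₛ^∞⟮I; F, E⟯ × C^∞⟮I, M; 𝓘(ℝ), ℝ⟯)
    (ξ : TotalSpace (F →L[ℝ] ℝ) (DualBundle E)) :
    affineFunction I F E (A.affineBracket (t⁻¹ • l.1, l.2) (t⁻¹ • l'.1, l'.2))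
        (fiberScaling (F →L[ℝ] ℝ) t ξ) =
      t⁻¹ * affineFunction I F E (A.affineBracket l l') ξ := by
  simp only [affineBracket_apply, map_smul, LinearMap.smul_apply, affineFunction_apply]
  change t * ξ.2 (t⁻¹ • t⁻¹ • A.bracket l.1 l'.1 ξ.proj) +
      (t⁻¹ * A.anchorAction l.1 l'.2 ξ.proj - t⁻¹ * A.anchorAction l'.1 l.2 ξ.proj) =
    t⁻¹ * (ξ.2 (A.bracket l.1 l'.1 ξ.proj) +
      (A.anchorAction l.1 l'.2 ξ.proj - A.anchorAction l'.1 l.2 ξ.proj))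
  rw [map_smul, map_smul, smul_eq_mul, smul_eq_mul]
  field_simp

theorem exists_poissonStructure (A : LieAlgebroidStructure I F E) :
    ∃ P : PoissonStructure (I.prod 𝓘(ℝ, F →L[ℝ] ℝ)) (TotalSpace (F →L[ℝ] ℝ) (DualBundle E)),
      P.IsFiberwiseLinear I ∧ ∀ l l', P.bracket (affineFunction I F E l) (affineFunction I F E l') =
        affineFunction I F E (A.affineBracket l l') := by
  have : T2Space (TotalSpace (F →L[ℝ] ℝ) (DualBundle E)) := t2Space_totalSpace
  obtain ⟨P, u, hu, hP⟩ := _root_.exists_poissonStructure (affineFunction I F E) A.affineBracket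
    A.affineBracket_self exists_differential_affineFunction_eq
    (fun ξ l h l' ↦ A.affineBracket_apply_eq_zero h l')
    (fun l l' l'' ↦ by rw [A.affineBracket_jacobi, map_add])
  refine ⟨P, ⟨u, hu, fun t ht ↦ ?_⟩, hP⟩
  funext ξ
  ext α
  obtain ⟨l, hl⟩ := exists_differential_affineFunction_eq ξ (α 0)
  obtain ⟨l', hl'⟩ := exists_differential_affineFunction_eq ξ (α 1)
  have hα : α = ![differential (I.prod 𝓘(ℝ, F →L[ℝ] ℝ)) (affineFunction I F E l) ξ,
      differential (I.prod 𝓘(ℝ, F →L[ℝ] ℝ)) (affineFunction I F E l') ξ] := by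
    funext i
    fin_cases i
    · exact hl.symm
    · exact hl'.symm
  have h2 : (1 - ((2 : ℕ) : ℤ)) = -1 := by norm_num
  change _ = t ^ (1 - ((2 : ℕ) : ℤ)) * u ξ α
  rw [hα, hu.pullback_apply ht, hu, hP, h2, zpow_neg_one, affineFunction_comp_fiberScalingMap,
    affineFunction_comp_fiberScalingMap, hP, affineFunction_affineBracket_fiberScaling A ht]

/-- Away from the zero section some linear function is nonzero and can be cancelled; positive rank
makes that region dense. -/
theorem eq_zero_of_mul_linearFunction_eq_zero (hF : 1 ≤ finrank ℝ F)
    {h : C^∞⟮I.prod 𝓘(ℝ, F →L[ℝ] ℝ), TotalSpace (F →L[ℝ] ℝ) (DualBundle E); 𝓘(ℝ), ℝ⟯}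
    (hh : ∀ τ : Cₛ^∞⟮I; F, E⟯, h * linearFunction τ = 0) : h = 0 := by
  have key : ∀ ξ : TotalSpace (F →L[ℝ] ℝ) (DualBundle E), ξ.2 ≠ 0 → h ξ = 0 := fun ξ hξ ↦ by
    obtain ⟨v, hv⟩ : ∃ v, ξ.2 v ≠ 0 := by
      by_contra! hcon
      exact hξ (ContinuousLinearMap.ext hcon)
    obtain ⟨τ, hτ⟩ := exists_section_apply_eq I F ξ.proj v
    have h1 : h ξ * ξ.2 (τ ξ.proj) = 0 := DFunLike.congr_fun (hh τ) ξ
    rw [hτ] at h1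
    exact (mul_eq_zero.1 h1).resolve_right hv
  ext ξ
  by_cases hξ : ξ.2 = 0
  · have hpos : 0 < finrank ℝ F := hF
    have : Nontrivial F := Module.nontrivial_of_finrank_pos hpos
    obtain ⟨w, hw⟩ := exists_ne (0 : F)
    obtain ⟨ℓ, hℓ⟩ := SeparatingDual.exists_ne_zero (R := ℝ) hw
    let e := (trivializationAt F E ξ.proj).continuousLinearEquivAt ℝ ξ.proj
      (mem_baseSet_trivializationAt F E ξ.proj)
    -- A nonzero covector in the same fiber: its multiples `t η`, `t ≠ 0`, approach the zero
    -- covector `ξ`.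
    let η : TotalSpace (F →L[ℝ] ℝ) (DualBundle E) :=
      ⟨ξ.proj, ℓ.comp (e : E ξ.proj →L[ℝ] F)⟩
    have hη : η.2 (e.symm w) ≠ 0 := by
      change ℓ (e (e.symm w)) ≠ 0
      rwa [e.apply_symm_apply]
    have hc : Continuous fun t : ℝ ↦ h (fiberScaling (F →L[ℝ] ℝ) t η) :=
      h.contMDiff.continuous.comp (contMDiff_fiberScaling_curve (I := I) η).continuous
    have h0 : fiberScaling (F →L[ℝ] ℝ) 0 η = ξ := by
      change TotalSpace.mk ξ.proj ((0 : ℝ) • η.2) = TotalSpace.mk ξ.proj ξ.2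
      rw [hξ, zero_smul]
    have h3 : Tendsto (fun t : ℝ ↦ h (fiberScaling (F →L[ℝ] ℝ) t η)) (𝓝[≠] 0) (𝓝 (h ξ)) := by
      have := hc.tendsto 0
      rw [h0] at this
      exact this.mono_left nhdsWithin_le_nhds
    have h4 : Tendsto (fun t : ℝ ↦ h (fiberScaling (F →L[ℝ] ℝ) t η)) (𝓝[≠] 0) (𝓝 0) := by
      refine tendsto_const_nhds.congr' (eventually_mem_nhdsWithin.mono fun t ht ↦ (key _ ?_).symm)
      intro hcon
      have h5 : t • η.2 (e.symm w) = 0 := DFunLike.congr_fun hcon (e.symm w)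
      exact (smul_eq_zero.1 h5).elim ht hη
    exact tendsto_nhds_unique h3 h4
  · exact key ξ hξ

theorem linearFunction_eq_zero_of_finrank_eq_zero (hF : finrank ℝ F = 0) (σ : Cₛ^∞⟮I; F, E⟯) :
    linearFunction σ = 0 := by
  have : Subsingleton F := Module.finrank_zero_iff.1 hF
  ext ξ
  let e := (trivializationAt F E ξ.proj).continuousLinearEquivAt ℝ ξ.proj
    (mem_baseSet_trivializationAt F E ξ.proj)
  have h1 : σ ξ.proj = 0 := e.injective (Subsingleton.elim _ _)
  rw [linearFunction_apply, h1, map_zero]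
  rfl

theorem Induces.bracket_affineFunction_of_one_le_finrank {A : LieAlgebroidStructure I F E}
    {P : PoissonStructure (I.prod 𝓘(ℝ, F →L[ℝ] ℝ)) (TotalSpace (F →L[ℝ] ℝ) (DualBundle E))}
    (h : A.Induces P) (hF : 1 ≤ finrank ℝ F)
    (l l' : Cₛ^∞⟮I; F, E⟯ × C^∞⟮I, M; 𝓘(ℝ), ℝ⟯) :
    P.bracket (affineFunction I F E l) (affineFunction I F E l') =
      affineFunction I F E (A.affineBracket l l') := by
  have h1 : ∀ σ f, P.bracket (linearFunction σ) (basePullback (F →L[ℝ] ℝ) (DualBundle E) f) =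
      basePullback _ _ (A.anchorAction σ f) := fun σ f ↦ by
    rw [← sub_eq_zero]
    refine eq_zero_of_mul_linearFunction_eq_zero hF fun τ ↦ ?_
    rw [sub_mul, h.bracket_basePullback_mul, sub_self]
  refine h.bracket_affineFunction h1 (fun f g ↦ ?_) l l'
  refine eq_zero_of_mul_linearFunction_eq_zero hF fun τ ↦ ?_
  -- The anchor is linear over functions while the Poisson bracket is a derivation; the discrepancy
  -- is the bracket of the two pullbacks times the linear function of `τ`.
  have h2 := h1 (ContMDiffSection.funSMul f τ) g
  have h3 : basePullback (F →L[ℝ] ℝ) (DualBundle E)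
      (A.anchorAction (ContMDiffSection.funSMul f τ) g) = basePullback _ _ f *
        basePullback _ _ (A.anchorAction τ g) := by
    ext ξ
    exact (congrArg (differential I g ξ.proj) (map_smul (A.anchor ξ.proj) (f ξ.proj)
      (τ ξ.proj))).trans (map_smul _ _ _)
  rw [linearFunction_funSMul, P.leibniz_left, h1, h3] at h2
  exact add_left_cancel (h2.trans (add_zero _).symm)

theorem Induces.bracket_affineFunction_of_finrank_eq_zero {A : LieAlgebroidStructure I F E}
    {P : PoissonStructure (I.prod 𝓘(ℝ, F →L[ℝ] ℝ)) (TotalSpace (F →L[ℝ] ℝ) (DualBundle E))}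
    (h : A.Induces P) (hF : finrank ℝ F = 0)
    (h0 : ∀ f g, P.bracket (basePullback (F →L[ℝ] ℝ) (DualBundle E) f) (basePullback _ _ g) = 0)
    (l l' : Cₛ^∞⟮I; F, E⟯ × C^∞⟮I, M; 𝓘(ℝ), ℝ⟯) :
    P.bracket (affineFunction I F E l) (affineFunction I F E l') =
      affineFunction I F E (A.affineBracket l l') := by
  refine h.bracket_affineFunction (fun σ f ↦ ?_) h0 l l'
  have : Subsingleton F := Module.finrank_zero_iff.1 hF
  rw [linearFunction_eq_zero_of_finrank_eq_zero hF, map_zero, LinearMap.zero_apply]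
  ext ξ
  let e := (trivializationAt F E ξ.proj).continuousLinearEquivAt ℝ ξ.proj
    (mem_baseSet_trivializationAt F E ξ.proj)
  have h1 : σ ξ.proj = 0 := e.injective (Subsingleton.elim _ _)
  exact (A.anchorAction_apply_eq_zero h1 f).symm

theorem exists_linear_poissonStructure_unique (A : LieAlgebroidStructure I F E) :
    ∃ P : PoissonStructure (I.prod 𝓘(ℝ, F →L[ℝ] ℝ)) (TotalSpace (F →L[ℝ] ℝ) (DualBundle E)),
      A.Induces P ∧ P.IsFiberwiseLinear I ∧
      (∀ Q, A.Induces Q → Q.IsFiberwiseLinear I → Q = P) ∧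
      ((1 ≤ finrank ℝ F ∨ finrank ℝ EM ≤ 1) → ∀ Q, A.Induces Q → Q = P) := by
  have : T2Space (TotalSpace (F →L[ℝ] ℝ) (DualBundle E)) := t2Space_totalSpace
  obtain ⟨P, hlin, hP⟩ := A.exists_poissonStructure
  have huniq : ∀ Q : PoissonStructure (I.prod 𝓘(ℝ, F →L[ℝ] ℝ))
      (TotalSpace (F →L[ℝ] ℝ) (DualBundle E)),
      (∀ l l', Q.bracket (affineFunction I F E l) (affineFunction I F E l') =
        affineFunction I F E (A.affineBracket l l')) → Q = P := fun Q hQ ↦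
    PoissonStructure.eq_of_bracket_eq exists_differential_affineFunction_eq
      fun l l' ↦ (hQ l l').trans (hP l l').symm
  refine ⟨P, fun σ τ ↦ ?_, hlin, fun Q hQ hQlin ↦ huniq Q ?_, fun hdim Q hQ ↦ huniq Q ?_⟩
  · have h1 := hP (σ, 0) (τ, 0)
    rw [affineBracket_apply] at h1
    simp only [map_zero, sub_self, affineFunction_inl] at h1
    exact h1
  · rcases Nat.eq_zero_or_pos (finrank ℝ F) with hF | hF
    · exact hQ.bracket_affineFunction_of_finrank_eq_zero hF
        hQlin.bracket_basePullback_basePullback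
    · exact hQ.bracket_affineFunction_of_one_le_finrank hF
  · rcases Nat.eq_zero_or_pos (finrank ℝ F) with hF | hF
    · refine hQ.bracket_affineFunction_of_finrank_eq_zero hF fun f g ↦
        Q.bracket_eq_zero_of_finrank_le_one ?_ _ _
      have hM : finrank ℝ EM ≤ 1 := hdim.resolve_left (by omega)
      have : Subsingleton F := Module.finrank_zero_iff.1 hF
      -- In rank zero the total space has the dimension of the base.
      rw [Module.finrank_prod, Module.finrank_zero_of_subsingleton (M := F →L[ℝ] ℝ), add_zero]
      exact hM
    · exact hQ.bracket_affineFunction_of_one_le_finrank hF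

end LieAlgebroidStructure

/-! ### Tangent vectors as derivations. -/

section PointDerivations

universe u

variable {EN : Type u} [NormedAddCommGroup EN] [NormedSpace ℝ EN] [FiniteDimensional ℝ EN]
  {HN : Type*} [TopologicalSpace HN] {J : ModelWithCorners ℝ EN HN} [J.Boundaryless]
  {N : Type*} [TopologicalSpace N] [ChartedSpace HN N] [IsManifold J ∞ N] [T2Space N]

/-- Derivations at a point are tangent vectors. -/
theorem exists_tangent_of_derivation {x : N} (D : C^∞⟮J, N; 𝓘(ℝ), ℝ⟯ →ₗ[ℝ] ℝ)
    (hD : ∀ f g, D (f * g) = D f * g x + f x * D g) :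
    ∃ v : TangentSpace J x, ∀ f, D f = differential J f x v := by
  let b : Basis (Fin (finrank ℝ EN)) ℝ EN := finBasis ℝ EN
  choose l hl using fun i ↦ exists_differential_eq (J := J) x (b.coord i).toContinuousLinearMap
  -- The components of the vector are the values of `D` on functions whose differentials at `x` are
  -- the dual basis.
  let v : EN := ∑ i, D (l i) • b i
  refine ⟨v, fun f ↦ ?_⟩
  let df : EN →L[ℝ] ℝ := differential J f x
  have h1 : differential J (f - ∑ i, df (b i) • l i) x = 0 := by
    have h2 : df = ∑ i, df (b i) • (b.coord i).toContinuousLinearMap := by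
      refine ContinuousLinearMap.coe_injective (b.ext fun j ↦ ?_)
      simp [Finsupp.single_apply]
    rw [differential_sub, differential_sum, sub_eq_zero]
    simp_rw [differential_smul, hl]
    exact h2
  have h3 := derivation_eq_zero_of_differential_eq_zero D hD h1
  rw [map_sub, map_sum, sub_eq_zero] at h3
  rw [h3]
  change _ = df v
  simp only [v, map_sum, map_smul, smul_eq_mul]
  exact Finset.sum_congr rfl fun i _ ↦ mul_comm _ _

end PointDerivations

/-! ### Fiberwise linear functions and homogeneity of degree one. -/

section LinearFunctionsOfDual

open Set Filter Topology

universe u v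

variable {EM : Type u} [NormedAddCommGroup EM] [NormedSpace ℝ EM]
  {HM : Type*} [TopologicalSpace HM] {I : ModelWithCorners ℝ EM HM}
  {M : Type*} [TopologicalSpace M] [ChartedSpace HM M]
  {F : Type v} [NormedAddCommGroup F] [NormedSpace ℝ F]
  {V : M → Type*} [TopologicalSpace (TotalSpace F V)]
  [∀ x, AddCommGroup (V x)] [∀ x, Module ℝ (V x)] [∀ x, TopologicalSpace (V x)]
  [FiberBundle F V] [VectorBundle ℝ F V] [ContMDiffVectorBundle ∞ F V I]

theorem linearFunctionOfDual_add (σ τ : Cₛ^∞⟮I; F →L[ℝ] ℝ, DualBundle V⟯) :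
    linearFunctionOfDual (σ + τ) = linearFunctionOfDual σ + linearFunctionOfDual τ := rfl

theorem linearFunctionOfDual_smul (c : ℝ) (σ : Cₛ^∞⟮I; F →L[ℝ] ℝ, DualBundle V⟯) :
    linearFunctionOfDual (c • σ) = c • linearFunctionOfDual σ := rfl

theorem linearFunctionOfDual_funSMul (f : C^∞⟮I, M; 𝓘(ℝ), ℝ⟯)
    (σ : Cₛ^∞⟮I; F →L[ℝ] ℝ, DualBundle V⟯) :
    linearFunctionOfDual (ContMDiffSection.funSMul f σ) =
      basePullback F V f * linearFunctionOfDual σ := rfl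

variable (I F V) in
/-- The map `σ ↦ φ_σ`. -/
def linearFunctionOfDualₗ : Cₛ^∞⟮I; F →L[ℝ] ℝ, DualBundle V⟯ →ₗ[ℝ]
    C^∞⟮I.prod 𝓘(ℝ, F), TotalSpace F V; 𝓘(ℝ), ℝ⟯ where
  toFun := linearFunctionOfDual
  map_add' := linearFunctionOfDual_add
  map_smul' := linearFunctionOfDual_smul

theorem linearFunctionOfDual_injective :
    Function.Injective (linearFunctionOfDual (I := I) (F := F) (E := V)) := fun σ τ h ↦ by
  ext x w
  exact DFunLike.congr_fun h (⟨x, w⟩ : TotalSpace F V)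

theorem linearFunctionOfDual_comp_fiberScalingMap (t : ℝ)
    (σ : Cₛ^∞⟮I; F →L[ℝ] ℝ, DualBundle V⟯) :
    (linearFunctionOfDual σ).comp (fiberScalingMap I F V t) = t • linearFunctionOfDual σ := by
  ext v
  exact map_smul (σ v.proj) t v.2

/-- A smooth function which is homogeneous of degree one on the fibers is linear on them. -/
theorem exists_clm_of_homogeneous {h : C^∞⟮I.prod 𝓘(ℝ, F), TotalSpace F V; 𝓘(ℝ), ℝ⟯}
    (hh : ∀ (t : ℝ) (v : TotalSpace F V), h (fiberScaling F t v) = t * h v) (x : M) :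
    ∃ s : V x →L[ℝ] ℝ, ∀ w : V x, s w = h ⟨x, w⟩ := by
  have hx := mem_baseSet_trivializationAt F V x
  set e := (trivializationAt F V x).continuousLinearEquivAt ℝ x hx with he
  let k : F → ℝ := fun w ↦ h ⟨x, e.symm w⟩
  have hk : DifferentiableAt ℝ k 0 := by
    have h1 : ContMDiff 𝓘(ℝ, F) 𝓘(ℝ) ∞ k :=
      h.contMDiff.comp (contMDiff_mk_symm (I := I) (F := F) (E := V) x)
    exact h1.contDiff.differentiable (by simp) 0
  -- Along the ray through `w` the function is `t * k w`, so `k` coincides with its own derivative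
  -- at the origin.
  have hlin : ∀ w, fderiv ℝ k 0 w = k w := fun w ↦ by
    have h1 : HasDerivAt (fun t : ℝ ↦ k (t • w)) (fderiv ℝ k 0 w) 0 := by
      have h2 : HasDerivAt (fun t : ℝ ↦ t • w) w 0 := by
        simpa using (hasDerivAt_id (0 : ℝ)).smul_const w
      have h3 : HasFDerivAt k (fderiv ℝ k 0) ((0 : ℝ) • w) := by
        rw [zero_smul]
        exact hk.hasFDerivAt
      exact h3.comp_hasDerivAt 0 h2
    have h4 : (fun t : ℝ ↦ k (t • w)) = fun t ↦ t * k w := by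
      ext t
      change h ⟨x, e.symm (t • w)⟩ = _
      rw [map_smul]
      exact hh t ⟨x, e.symm w⟩
    rw [h4] at h1
    have h5 : HasDerivAt (fun t : ℝ ↦ t * k w) (k w) 0 := by
      simpa using (hasDerivAt_id (0 : ℝ)).mul_const (k w)
    exact h1.unique h5
  refine ⟨(fderiv ℝ k 0).comp (e : V x →L[ℝ] F), fun w ↦ (hlin _).trans ?_⟩
  change h ⟨x, e.symm (e w)⟩ = _
  rw [e.symm_apply_apply]

theorem exists_linearFunctionOfDual_eq [FiniteDimensional ℝ F] [FiniteDimensional ℝ EM]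
    [T2Space M] [IsManifold I ∞ M] {h : C^∞⟮I.prod 𝓘(ℝ, F), TotalSpace F V; 𝓘(ℝ), ℝ⟯}
    (hh : ∀ (t : ℝ) (v : TotalSpace F V), h (fiberScaling F t v) = t * h v) :
    ∃ σ : Cₛ^∞⟮I; F →L[ℝ] ℝ, DualBundle V⟯, linearFunctionOfDual σ = h := by
  choose s hs using exists_clm_of_homogeneous hh
  refine ⟨⟨s, contMDiff_hom_of_apply_section (E' := Bundle.Trivial M ℝ) fun τ ↦ ?_⟩, ?_⟩
  · intro x
    rw [contMDiffAt_section]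
    exact ((h.contMDiff.comp τ.contMDiff).congr fun y ↦ hs y (τ y)) x
  · ext v
    exact hs v.proj v.2

end LinearFunctionsOfDual

/-! ### The Lie algebroid of a linear Poisson structure. -/

namespace PoissonStructure.IsFiberwiseLinear

open Set Filter Topology

universe u v

variable {EM : Type u} [NormedAddCommGroup EM] [NormedSpace ℝ EM]
  {HM : Type*} [TopologicalSpace HM] {I : ModelWithCorners ℝ EM HM}
  {M : Type*} [TopologicalSpace M] [ChartedSpace HM M]
  {F : Type v} [NormedAddCommGroup F] [NormedSpace ℝ F]
  {V : M → Type*} [TopologicalSpace (TotalSpace F V)]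
  [∀ x, AddCommGroup (V x)] [∀ x, Module ℝ (V x)] [∀ x, TopologicalSpace (V x)]
  [FiberBundle F V] [VectorBundle ℝ F V] [ContMDiffVectorBundle ∞ F V I]
  {P : PoissonStructure (I.prod 𝓘(ℝ, F)) (TotalSpace F V)}

/-- Two factors `t⁻¹` from the arguments against one from linearity leave degree one for `t ≠ 0`;
continuity in `t` covers `t = 0`. -/
theorem bracket_linearFunctionOfDual_fiberScaling (hP : P.IsFiberwiseLinear I)
    (σ τ : Cₛ^∞⟮I; F →L[ℝ] ℝ, DualBundle V⟯) (t : ℝ) (v : TotalSpace F V) :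
    P.bracket (linearFunctionOfDual σ) (linearFunctionOfDual τ) (fiberScaling F t v) =
      t * P.bracket (linearFunctionOfDual σ) (linearFunctionOfDual τ) v := by
  set h := P.bracket (linearFunctionOfDual σ) (linearFunctionOfDual τ) with hh
  have h1 : ∀ t : ℝ, t ≠ 0 → h (fiberScaling F t v) = t * h v := fun t ht ↦ by
    have h2 := hP.bracket_comp ht (linearFunctionOfDual σ) (linearFunctionOfDual τ) v
    simp only [linearFunctionOfDual_comp_fiberScalingMap, map_smul, LinearMap.smul_apply] at h2
    rw [← hh] at h2
    change t⁻¹ * (t⁻¹ * h (fiberScaling F t v)) = t⁻¹ * h v at h2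
    rw [mul_right_inj' (inv_ne_zero ht)] at h2
    rw [← h2, mul_inv_cancel_left₀ ht]
  have hc : Continuous fun t : ℝ ↦ h (fiberScaling F t v) :=
    h.contMDiff.continuous.comp (contMDiff_fiberScaling_curve (I := I) v).continuous
  have h2 : (fun t : ℝ ↦ h (fiberScaling F t v)) = fun t ↦ t * h v :=
    hc.ext_on (dense_compl_singleton 0) (by fun_prop) h1
  exact congrFun h2 t

theorem bracket_basePullback_fiberScaling (hP : P.IsFiberwiseLinear I)
    (σ : Cₛ^∞⟮I; F →L[ℝ] ℝ, DualBundle V⟯) (f : C^∞⟮I, M; 𝓘(ℝ), ℝ⟯) (t : ℝ)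
    (v : TotalSpace F V) :
    P.bracket (linearFunctionOfDual σ) (basePullback F V f) (fiberScaling F t v) =
      P.bracket (linearFunctionOfDual σ) (basePullback F V f) v := by
  set h := P.bracket (linearFunctionOfDual σ) (basePullback F V f) with hh
  have h1 : ∀ t : ℝ, t ≠ 0 → h (fiberScaling F t v) = h v := fun t ht ↦ by
    have h2 := hP.bracket_comp ht (linearFunctionOfDual σ) (basePullback F V f) v
    have h3 : (basePullback F V f).comp (fiberScalingMap I F V t⁻¹) = basePullback F V f := rfl
    rw [linearFunctionOfDual_comp_fiberScalingMap, map_smul, LinearMap.smul_apply, h3, ← hh] at h2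
    change t⁻¹ * h (fiberScaling F t v) = t⁻¹ * h v at h2
    rwa [mul_right_inj' (inv_ne_zero ht)] at h2
  have hc : Continuous fun t : ℝ ↦ h (fiberScaling F t v) :=
    h.contMDiff.continuous.comp (contMDiff_fiberScaling_curve (I := I) v).continuous
  have h2 : (fun t : ℝ ↦ h (fiberScaling F t v)) = fun _ ↦ h v :=
    hc.ext_on (dense_compl_singleton 0) continuous_const h1
  exact congrFun h2 t

theorem bracket_basePullback_apply (hP : P.IsFiberwiseLinear I)
    (σ : Cₛ^∞⟮I; F →L[ℝ] ℝ, DualBundle V⟯) (f : C^∞⟮I, M; 𝓘(ℝ), ℝ⟯) (v : TotalSpace F V) :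
    P.bracket (linearFunctionOfDual σ) (basePullback F V f) v =
      P.bracket (linearFunctionOfDual σ) (basePullback F V f) ⟨v.proj, 0⟩ := by
  rw [← hP.bracket_basePullback_fiberScaling σ f 0 v]
  congr 1
  exact congrArg (TotalSpace.mk v.proj) (zero_smul ℝ v.2)

variable [FiniteDimensional ℝ EM] [T2Space M] [IsManifold I ∞ M] [I.Boundaryless]
  [FiniteDimensional ℝ F]

/-- The bracket with a pullback is linear over functions in `σ`, since pullbacks commute; a frame
expansion then shows that it depends only on the value of `σ` at the point. -/
theorem bracket_basePullback_apply_eq_zero (hP : P.IsFiberwiseLinear I)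
    {σ : Cₛ^∞⟮I; F →L[ℝ] ℝ, DualBundle V⟯} {v : TotalSpace F V} (h : σ v.proj = 0)
    (f : C^∞⟮I, M; 𝓘(ℝ), ℝ⟯) :
    P.bracket (linearFunctionOfDual σ) (basePullback F V f) v = 0 := by
  obtain ⟨s, hs⟩ := exists_section_frame I (F →L[ℝ] ℝ) (DualBundle V) v.proj
  obtain ⟨g, k, hg, -, hk, hσ⟩ := hs σ
  have h1 : ∀ (g : C^∞⟮I, M; 𝓘(ℝ), ℝ⟯) (τ : Cₛ^∞⟮I; F →L[ℝ] ℝ, DualBundle V⟯), g v.proj = 0 →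
      P.bracket (linearFunctionOfDual (ContMDiffSection.funSMul g τ)) (basePullback F V f) v =
        0 := fun g τ hg ↦ by
    rw [linearFunctionOfDual_funSMul, P.leibniz_left, hP.bracket_basePullback_basePullback,
      zero_mul, add_zero]
    change g v.proj * _ = 0
    rw [hg, zero_mul]
  let D : Cₛ^∞⟮I; F →L[ℝ] ℝ, DualBundle V⟯ →ₗ[ℝ] ℝ :=
    evalₗ v ∘ₗ P.bracket.flip (basePullback F V f) ∘ₗ linearFunctionOfDualₗ I F V
  change D σ = 0
  rw [hσ, map_add, map_sum]
  exact (congrArg₂ (· + ·) (h1 g σ hg)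
    (Finset.sum_eq_zero fun i _ ↦ h1 (k i) (s i) (hk h i))).trans (add_zero 0)

/-- For one section with value `β`, the bracket with pullbacks, evaluated at the zero vector over
`x`, is a derivation at `x` and hence a tangent vector. Another section with that value gives the
same vector. -/
theorem exists_anchor_apply (hP : P.IsFiberwiseLinear I) (x : M) (β : DualBundle V x) :
    ∃ X : TangentSpace I x, ∀ σ : Cₛ^∞⟮I; F →L[ℝ] ℝ, DualBundle V⟯, σ x = β →
      ∀ f, P.bracket (linearFunctionOfDual σ) (basePullback F V f) ⟨x, 0⟩ =
        differential I f x X := by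
  obtain ⟨τ, hτ⟩ := exists_section_apply_eq (E := DualBundle V) I (F →L[ℝ] ℝ) x β
  let D : C^∞⟮I, M; 𝓘(ℝ), ℝ⟯ →ₗ[ℝ] ℝ :=
    { toFun := fun f ↦ P.bracket (linearFunctionOfDual τ) (basePullback F V f) ⟨x, 0⟩
      map_add' := fun f g ↦ by
        rw [basePullback_add, map_add]
        rfl
      map_smul' := fun c f ↦ by
        rw [basePullback_smul, map_smul]
        rfl }
  obtain ⟨X, hX⟩ := exists_tangent_of_derivation (x := x) D fun f g ↦
    DFunLike.congr_fun (P.leibniz (linearFunctionOfDual τ) (basePullback F V f)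
      (basePullback F V g)) ⟨x, 0⟩
  refine ⟨X, fun σ hσ f ↦ ?_⟩
  rw [← hX, ← sub_eq_zero]
  have h1 := hP.bracket_basePullback_apply_eq_zero (σ := σ - τ) (v := ⟨x, 0⟩)
    (by rw [ContMDiffSection.coe_sub, Pi.sub_apply, hσ, hτ, sub_self]) f
  have h2 : linearFunctionOfDual (σ - τ) = linearFunctionOfDual σ - linearFunctionOfDual τ :=
    map_sub (linearFunctionOfDualₗ I F V) σ τ
  rw [h2, map_sub] at h1
  exact h1

theorem exists_anchor (hP : P.IsFiberwiseLinear I) :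
    ∃ a : Cₛ^∞⟮I; (F →L[ℝ] ℝ) →L[ℝ] EM, fun x ↦ DualBundle V x →L[ℝ] TangentSpace I x⟯,
      ∀ σ f v, P.bracket (linearFunctionOfDual σ) (basePullback F V f) v =
        differential I f v.proj (a v.proj (σ v.proj)) := by
  choose a ha using hP.exists_anchor_apply
  have ha' : ∀ (x : M) (σ : Cₛ^∞⟮I; F →L[ℝ] ℝ, DualBundle V⟯) (f : C^∞⟮I, M; 𝓘(ℝ), ℝ⟯),
      P.bracket (linearFunctionOfDual σ) (basePullback F V f) ⟨x, 0⟩ =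
        differential I f x (a x (σ x)) := fun x σ f ↦ ha x (σ x) σ rfl f
  have hadd : ∀ x β γ, a x (β + γ) = a x β + a x γ := fun x β γ ↦ by
    obtain ⟨σ, rfl⟩ := exists_section_apply_eq (E := DualBundle V) I (F →L[ℝ] ℝ) x β
    obtain ⟨τ, rfl⟩ := exists_section_apply_eq (E := DualBundle V) I (F →L[ℝ] ℝ) x γ
    rw [← sub_eq_zero]
    refine eq_zero_of_differential_apply_eq_zero fun f ↦ ?_
    have h1 := ha' x (σ + τ) f
    rw [linearFunctionOfDual_add, map_add] at h1
    rw [map_sub, map_add, ← ha' x σ f, ← ha' x τ f, sub_eq_zero]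
    exact h1.symm
  have hsmul : ∀ x (c : ℝ) β, a x (c • β) = c • a x β := fun x c β ↦ by
    obtain ⟨σ, rfl⟩ := exists_section_apply_eq (E := DualBundle V) I (F →L[ℝ] ℝ) x β
    rw [← sub_eq_zero]
    refine eq_zero_of_differential_apply_eq_zero fun f ↦ ?_
    have h1 := ha' x (c • σ) f
    rw [linearFunctionOfDual_smul, map_smul] at h1
    rw [map_sub, map_smul, ← ha' x σ f, sub_eq_zero]
    exact h1.symm
  have hclm : ∀ x, ∃ A : DualBundle V x →L[ℝ] TangentSpace I x, ∀ β, A β = a x β := fun x ↦ by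
    let e := (trivializationAt (F →L[ℝ] ℝ) (DualBundle V) x).continuousLinearEquivAt ℝ x
      (mem_baseSet_trivializationAt (F →L[ℝ] ℝ) (DualBundle V) x)
    let L : DualBundle V x →ₗ[ℝ] EM :=
      { toFun := a x, map_add' := hadd x, map_smul' := hsmul x }
    let T : (F →L[ℝ] ℝ) →L[ℝ] EM :=
      LinearMap.toContinuousLinearMap (L ∘ₗ (e.symm.toLinearEquiv : _ →ₗ[ℝ] _))
    refine ⟨T.comp (e : DualBundle V x →L[ℝ] F →L[ℝ] ℝ), fun β ↦ ?_⟩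
    exact congrArg (a x) (e.symm_apply_apply β)
  choose A hA using hclm
  refine ⟨⟨A, contMDiff_hom_of_apply_section (E := DualBundle V) (E' := TangentSpace I)
    fun σ ↦ contMDiff_of_differential_apply fun f ↦ ?_⟩, fun σ f v ↦ ?_⟩
  · have h1 : ContMDiff I (I.prod 𝓘(ℝ, F)) ∞ (fun x ↦ TotalSpace.mk' F x (0 : V x)) :=
      contMDiff_zeroSection ℝ V
    refine ((P.bracket (linearFunctionOfDual σ) (basePullback F V f)).contMDiff.comp h1).congr
      fun x ↦ ?_
    rw [hA]
    exact (ha' x σ f).symm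
  · rw [hP.bracket_basePullback_apply, ha']
    exact congrArg (differential I f v.proj) (hA _ _).symm

theorem exists_sectionBracket (hP : P.IsFiberwiseLinear I) :
    ∃ B : Cₛ^∞⟮I; F →L[ℝ] ℝ, DualBundle V⟯ →ₗ[ℝ] Cₛ^∞⟮I; F →L[ℝ] ℝ, DualBundle V⟯ →ₗ[ℝ]
        Cₛ^∞⟮I; F →L[ℝ] ℝ, DualBundle V⟯,
      ∀ σ τ, P.bracket (linearFunctionOfDual σ) (linearFunctionOfDual τ) =
        linearFunctionOfDual (B σ τ) := by
  choose B hB using fun σ τ : Cₛ^∞⟮I; F →L[ℝ] ℝ, DualBundle V⟯ ↦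
    exists_linearFunctionOfDual_eq (hP.bracket_linearFunctionOfDual_fiberScaling σ τ)
  refine ⟨LinearMap.mk₂ ℝ B (fun σ σ' τ ↦ ?_) (fun c σ τ ↦ ?_) (fun σ τ τ' ↦ ?_)
    (fun c σ τ ↦ ?_), fun σ τ ↦ (hB σ τ).symm⟩ <;>
  apply linearFunctionOfDual_injective
  · rw [linearFunctionOfDual_add, hB, hB, hB, linearFunctionOfDual_add, map_add,
      LinearMap.add_apply]
  · rw [linearFunctionOfDual_smul, hB, hB, linearFunctionOfDual_smul, map_smul,
      LinearMap.smul_apply]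
  · rw [linearFunctionOfDual_add, hB, hB, hB, linearFunctionOfDual_add, map_add]
  · rw [linearFunctionOfDual_smul, hB, hB, linearFunctionOfDual_smul, map_smul]

theorem exists_lieAlgebroidStructure (hP : P.IsFiberwiseLinear I) :
    ∃ A : LieAlgebroidStructure I (F →L[ℝ] ℝ) (DualBundle V), A.InducesOnPredual P := by
  obtain ⟨a, ha⟩ := hP.exists_anchor
  obtain ⟨B, hB⟩ := hP.exists_sectionBracket
  refine ⟨⟨B, a, fun σ ↦ ?_, fun σ τ ρ ↦ ?_, fun σ τ f x ↦ ?_⟩, hB⟩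
  · apply linearFunctionOfDual_injective
    rw [← hB, P.bracket_self]
    exact (map_zero (linearFunctionOfDualₗ I F V)).symm
  · apply linearFunctionOfDual_injective
    rw [linearFunctionOfDual_add]
    simp only [← hB]
    exact P.jacobi _ _ _
  · ext w
    have h1 := DFunLike.congr_fun (hB σ (ContMDiffSection.funSMul f τ)) (⟨x, w⟩ : TotalSpace F V)
    rw [linearFunctionOfDual_funSMul, P.leibniz, hB] at h1
    refine h1.symm.trans ?_
    change P.bracket (linearFunctionOfDual σ) (basePullback F V f) ⟨x, w⟩ * τ x w +
      f x * B σ τ x w = f x * B σ τ x w + differential I f x (a x (σ x)) * τ x w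
    rw [ha, add_comm]

end PoissonStructure.IsFiberwiseLinear

/-! ### Uniqueness of the Lie algebroid structure. -/

namespace LieAlgebroidStructure

universe u v

variable {EM : Type u} [NormedAddCommGroup EM] [NormedSpace ℝ EM]
  {HM : Type*} [TopologicalSpace HM] {I : ModelWithCorners ℝ EM HM}
  {M : Type*} [TopologicalSpace M] [ChartedSpace HM M]
  [FiniteDimensional ℝ EM] [T2Space M] [IsManifold I ∞ M] [I.Boundaryless]
  {F : Type v} [NormedAddCommGroup F] [NormedSpace ℝ F]
  {E : M → Type*} [TopologicalSpace (TotalSpace F E)]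
  [∀ x, AddCommGroup (E x)] [∀ x, Module ℝ (E x)] [∀ x, TopologicalSpace (E x)]
  [FiberBundle F E] [VectorBundle ℝ F E] [ContMDiffVectorBundle ∞ F E I]

/-- The anchor of a Lie algebroid is determined by the bracket. -/
theorem eq_of_bracket_eq {A A' : LieAlgebroidStructure I F E} (h : A.bracket = A'.bracket) :
    A = A' := by
  refine LieAlgebroidStructure.ext h ?_
  ext x β
  obtain ⟨σ, rfl⟩ := exists_section_apply_eq I F x β
  by_cases h0 : σ x = 0
  · rw [h0, map_zero, map_zero]
  rw [← sub_eq_zero]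
  refine eq_zero_of_differential_apply_eq_zero fun f ↦ ?_
  -- Using `σ` in both slots, the anchor terms are multiples of the nonzero vector `σ x`, so their
  -- coefficients agree.
  have h1 := A.leibniz σ σ f x
  rw [h, A'.leibniz σ σ f x, add_right_inj] at h1
  rw [map_sub, sub_eq_zero]
  exact (smul_left_injective ℝ h0 h1).symm

end LieAlgebroidStructure

section Uniqueness

variable {EM : Type*} [NormedAddCommGroup EM] [NormedSpace ℝ EM]
  {HM : Type*} [TopologicalSpace HM] {I : ModelWithCorners ℝ EM HM}
  {M : Type*} [TopologicalSpace M] [ChartedSpace HM M]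
  [FiniteDimensional ℝ EM] [T2Space M] [IsManifold I ∞ M] [I.Boundaryless]
  {F : Type*} [NormedAddCommGroup F] [NormedSpace ℝ F] [FiniteDimensional ℝ F]
  {V : M → Type*} [TopologicalSpace (TotalSpace F V)]
  [∀ x, AddCommGroup (V x)] [∀ x, Module ℝ (V x)] [∀ x, TopologicalSpace (V x)]
  [FiberBundle F V] [VectorBundle ℝ F V] [ContMDiffVectorBundle ∞ F V I]

theorem PoissonStructure.IsFiberwiseLinear.existsUnique_lieAlgebroidStructure
    {P : PoissonStructure (I.prod 𝓘(ℝ, F)) (TotalSpace F V)} (hP : P.IsFiberwiseLinear I) :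
    ∃! A : LieAlgebroidStructure I (F →L[ℝ] ℝ) (DualBundle V), A.InducesOnPredual P := by
  obtain ⟨A, hA⟩ := hP.exists_lieAlgebroidStructure
  refine ⟨A, hA, fun A' hA' ↦ LieAlgebroidStructure.eq_of_bracket_eq ?_⟩
  refine LinearMap.ext₂ fun σ τ ↦ linearFunctionOfDual_injective ?_
  rw [← hA, ← hA']

end Uniqueness

end

theorem mainTheorem8
    {EM : Type*} [NormedAddCommGroup EM] [NormedSpace ℝ EM] [FiniteDimensional ℝ EM]
    {HM : Type*} [TopologicalSpace HM] (I : ModelWithCorners ℝ EM HM) [I.Boundaryless]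
    {M : Type*} [TopologicalSpace M] [ChartedSpace HM M] [IsManifold I ∞ M]
    [T2Space M] [SigmaCompactSpace M] :
    -- every Lie algebroid `E → M` induces a linear Poisson structure on `E*`
    (∀ {F : Type*} [NormedAddCommGroup F] [NormedSpace ℝ F] [FiniteDimensional ℝ F]
      {E : M → Type*} [TopologicalSpace (TotalSpace F E)]
      [∀ x, AddCommGroup (E x)] [∀ x, Module ℝ (E x)] [∀ x, TopologicalSpace (E x)]
      [FiberBundle F E] [VectorBundle ℝ F E] [ContMDiffVectorBundle ∞ F E I]
      (A : LieAlgebroidStructure I F E),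
      ∃ P : PoissonStructure (I.prod 𝓘(ℝ, F →L[ℝ] ℝ)) (TotalSpace (F →L[ℝ] ℝ) (DualBundle E)),
        A.Induces P ∧ P.IsFiberwiseLinear I ∧
        (∀ Q, A.Induces Q → Q.IsFiberwiseLinear I → Q = P) ∧
        ((1 ≤ finrank ℝ F ∨ finrank ℝ EM ≤ 1) → ∀ Q, A.Induces Q → Q = P)) ∧
    -- every linear Poisson structure on `V` arises from a unique Lie algebroid structure on `V*`
    (∀ {F : Type*} [NormedAddCommGroup F] [NormedSpace ℝ F] [FiniteDimensional ℝ F]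
      {V : M → Type*} [TopologicalSpace (TotalSpace F V)]
      [∀ x, AddCommGroup (V x)] [∀ x, Module ℝ (V x)] [∀ x, TopologicalSpace (V x)]
      [FiberBundle F V] [VectorBundle ℝ F V] [ContMDiffVectorBundle ∞ F V I]
      (P : PoissonStructure (I.prod 𝓘(ℝ, F)) (TotalSpace F V)),
      P.IsFiberwiseLinear I →
        ∃! A : LieAlgebroidStructure I (F →L[ℝ] ℝ) (DualBundle V), A.InducesOnPredual P) :=
  ⟨fun A ↦ A.exists_linear_poissonStructure_unique,
    fun _ hP ↦ hP.existsUnique_lieAlgebroidStructure⟩
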